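/- For a finite tree $T$ with diameter $D$, let $d_i(T)$ be the number of unordered pairs of vertices of $T$ at distance exactly $i$, let $W(T;x)=\sum_{i=1}^{D} d_i(T)x^i$ be its Wiener polynomial, and call the complex roots of the reduced Wiener polynomial $W(T;x)/x$ the Wiener roots of $T$. For $n\ge 8$ let $T_n$ be the tree of order $n$ obtained from a path on $7$ vertices by joining a new vertex $v$ to the middle vertex of the path and then attaching $n-8$ leaves to $v$. For every $n\ge 31$, $T_n$ is, up to isomorphism, the unique tree of order $n$ with a Wiener root of maximum modulus: $T_n$ has a Wiener root $z$ such that $|w|\le |z|$ for every Wiener root $w$ of every tree of order $n$, and every tree of order $n$ that has a Wiener root with this property is isomorphic to $T_n$. -/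

import Mathlib

namespace SimpleGraph

variable {V : Type*}

/-- `d_i(G)` for `i ≥ 1`: the number of unordered pairs of vertices of `G` at distance exactly `i`. -/
noncomputable def numPairsAtDist (G : SimpleGraph V) (i : ℕ) : ℕ :=
  {e : Sym2 V | ∃ u v : V, e = s(u, v) ∧ G.dist u v = i}.ncard

/-- The Wiener polynomial `W(G; x) = ∑_{i=1}^{D(G)} d_i(G) x^i` of a (finite connected) graph,
where `D(G)` is the diameter. -/
noncomputable def wienerPoly (G : SimpleGraph V) : Polynomial ℂ :=
  ∑ i ∈ Finset.Icc 1 G.diam, Polynomial.C (G.numPairsAtDist i : ℂ) * Polynomial.X ^ i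

/-- The reduced Wiener polynomial `W(G; x) / x`. -/
noncomputable def reducedWienerPoly (G : SimpleGraph V) : Polynomial ℂ :=
  (wienerPoly G).divX

/-- The division by `x` in the reduced Wiener polynomial is exact. -/
theorem reducedWienerPoly_mul_X (G : SimpleGraph V) :
    G.reducedWienerPoly * Polynomial.X = G.wienerPoly := by
  have h0 : G.wienerPoly.coeff 0 = 0 := by
    unfold wienerPoly
    rw [Polynomial.finsetSum_coeff]
    refine Finset.sum_eq_zero fun i hi => ?_
    have hi1 : 0 ≠ i := by
      have := (Finset.mem_Icc.mp hi).1
      omega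
    rw [Polynomial.coeff_C_mul_X_pow, if_neg hi1]
  have h := Polynomial.divX_mul_X_add G.wienerPoly
  rwa [h0, Polynomial.C_0, add_zero] at h

/-- The Wiener roots of `G` are the complex roots of its reduced Wiener polynomial. -/
def IsWienerRoot (G : SimpleGraph V) (z : ℂ) : Prop :=
  G.reducedWienerPoly.IsRoot z

/-- `G` has a Wiener root whose modulus is the maximum of the moduli of all Wiener roots of all
trees having the same order as `G`. -/
def HasMaxModulusWienerRoot {V : Type*} (G : SimpleGraph V) : Prop :=
  ∃ z : ℂ, G.IsWienerRoot z ∧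
    ∀ S : SimpleGraph (Fin (Nat.card V)), S.IsTree →
      ∀ w : ℂ, S.IsWienerRoot w → ‖w‖ ≤ ‖z‖

/-- The tree `T_n` (for `n ≥ 8`): vertices `0, 1, …, 6` form a path in this order, vertex `7` is
adjacent to the middle vertex `3` of the path, and each of the remaining `n - 8` vertices
`8, …, n - 1` is adjacent to vertex `7` only. -/
def treeT (n : ℕ) : SimpleGraph (Fin n) :=
  SimpleGraph.fromRel fun i j : Fin n =>
    (j.val = i.val + 1 ∧ j.val ≤ 6) ∨ (i.val = 3 ∧ j.val = 7) ∨ (i.val = 7 ∧ 8 ≤ j.val)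

end SimpleGraph

/-!
Write `d_i` for the number of pairs at distance `i`. The tree `treeT n` has `d_6 = 1`,
`d_5 = 2 * n - 14` and `d_4` close to `2 * n`, so its reduced Wiener polynomial changes sign to the
left of `-(2 * n - 16)` (`exists_isWienerRoot_treeT`). The theorem follows from the gap: in every
other tree of order `n ≥ 31` all Wiener roots have modulus at most `2 * n - 16`
(`IsTree.nonempty_iso_treeT_or_norm_le`).

By the Eneström–Kakeya bound (`norm_le_of_sum_mul_pow_eq_zero`) a root larger than that requires
`d_i > (2 * n - 16) * d_{i + 1}` for some `i` below the diameter. In a tree, one end of each pair at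
distance `i` has a vertex at distance `i + 1` (`IsTree.exists_dist_eq_add_one`), and averaging over
the pairs `u, x` at distance `i + 1` produces such a pair for which the ratios of sphere sizes
`|S_i| / |S_{i + 1}|` around `u` and `x` add up to more than `2 * n - 16`
(`IsTree.numPairsAtDist_le_mul`). So nearly all vertices lie at distance `i` from both `u` and `x`.
By parity and because the path from `u` to `x` uses up vertices, this is possible only for `i = 3`
and `i = 5` (`IsTree.of_lt_sphereRatio_add`). All metric information on trees that is needed
is the four-point condition (`IsTree.dist_add_dist_le`) and parity.

* For `i = 3` nearly all vertices are neighbours of the midpoint `c` of the path. Either some vertex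
  is at distance three from `c`, and then `d_4` is too large for the ratio in question, or the tree
  is a star with two edges subdivided, where `d_4 = 1` and `d_3 = 2 * n - 8`, but where the term
  `d_2` of order `n ^ 2 / 2` keeps the roots small
  (`IsTree.norm_le_of_unique_pair_at_dist_four`).
* For `i = 5` all but at most one of the vertices off the path hang at a single neighbour of `c` or
  are that neighbour. If there is no exception, the tree is `treeT n`
  (`IsTree.nonempty_iso_treeT`). If there is one, then `d_5 = 2 * n - 15` and `d_4` is about `3 * n`,
  which again keeps the roots small (`IsTree.norm_le_of_unique_pair_at_dist_six`).

In both exceptional trees the polynomial is monic, and its three leading terms form a power of the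
variable times a quadratic with real roots, whose modulus on a circle around zero is bounded below
by its value at the negative real point (`norm_sq_sub_mul_add_le`).
-/

namespace SimpleGraph

variable {V : Type*} {G : SimpleGraph V} {u v w x y a b c : V} {i k : ℕ}

/-! ### Distances in trees -/

lemma Connected.exists_adj_dist_add_one_eq (hG : G.Connected) (h : u ≠ w) :
    ∃ x, G.Adj u x ∧ G.dist x w + 1 = G.dist u w := by
  obtain ⟨p, hp⟩ := hG.exists_walk_length_eq_dist u w
  cases p with
  | nil => exact absurd rfl h
  | @cons _ x _ hux q =>
    refine ⟨x, hux, ?_⟩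
    have h1 : G.dist x w ≤ q.length := dist_le q
    have h2 : G.dist u w ≤ G.dist u x + G.dist x w := hG.dist_triangle
    rw [dist_eq_one_iff_adj.2 hux] at h2
    rw [Walk.length_cons] at hp
    omega

/-- Geodesics pass through every intermediate distance. -/
lemma Connected.exists_dist_eq_and_dist_eq_sub (hG : G.Connected) (h : k ≤ G.dist u v) :
    ∃ x, G.dist u x = k ∧ G.dist x v = G.dist u v - k := by
  induction k with
  | zero => exact ⟨u, by simp⟩
  | succ k ih =>
    obtain ⟨x, hx1, hx2⟩ := ih (by omega)
    have hne : x ≠ v := by rintro rfl; simp at hx2; omega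
    obtain ⟨y, hxy, hy⟩ := hG.exists_adj_dist_add_one_eq hne
    have h2 : G.dist u y ≤ G.dist u x + G.dist x y := hG.dist_triangle
    have h3 : G.dist u v ≤ G.dist u y + G.dist y v := hG.dist_triangle
    rw [dist_eq_one_iff_adj.2 hxy] at h2
    exact ⟨y, by omega, by omega⟩

/-- In a tree rooted at `a`, the parent of a vertex is unique. -/
lemma IsTree.eq_of_adj_of_dist_add_one_eq (hG : G.IsTree) (hx : G.Adj x v) (hy : G.Adj y v)
    (hdx : G.dist a x + 1 = G.dist a v) (hdy : G.dist a y + 1 = G.dist a v) : x = y := by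
  obtain ⟨p, hp⟩ := hG.connected.exists_walk_length_eq_dist a x
  obtain ⟨q, hq⟩ := hG.connected.exists_walk_length_eq_dist a y
  have hp' : (p.concat hx).IsPath :=
    Walk.isPath_of_length_eq_dist _ (by rw [Walk.length_concat]; omega)
  have hq' : (q.concat hy).IsPath :=
    Walk.isPath_of_length_eq_dist _ (by rw [Walk.length_concat]; omega)
  have h : p.concat hx = q.concat hy :=
    congrArg Subtype.val ((hG.isAcyclic.subsingleton_path a v).elim ⟨_, hp'⟩ ⟨_, hq'⟩)
  exact (Walk.concat_inj h).1

/-- If the edge `uv` leads away from `a` and towards `b`, then it lies on the geodesic between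
them. -/
lemma IsTree.dist_eq_add_of_adj (hG : G.IsTree) (huv : G.Adj u v)
    (ha : G.dist a v = G.dist a u + 1) (hb : G.dist u b = G.dist v b + 1) :
    G.dist a b = G.dist a u + 1 + G.dist v b := by
  induction hk : G.dist v b generalizing u v with
  | zero =>
    obtain rfl : v = b := hG.connected.dist_eq_zero_iff.1 hk
    omega
  | succ k ih =>
    have hne : v ≠ b := by rintro rfl; simp at hk
    obtain ⟨x, hvx, hx⟩ := hG.connected.exists_adj_dist_add_one_eq hne
    rcases hG.dist_eq_dist_add_one_of_adj a hvx with h | h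
    · obtain rfl : u = x := hG.eq_of_adj_of_dist_add_one_eq huv hvx.symm ha.symm h.symm
      omega
    · rw [ih hvx h (by omega) (by omega)]
      omega

/-- The four-point condition: trees are `0`-hyperbolic. -/
lemma IsTree.dist_add_dist_le (hG : G.IsTree) (u w a b : V) :
    G.dist u w + G.dist a b ≤
      max (G.dist u a + G.dist w b) (G.dist u b + G.dist w a) := by
  induction hk : G.dist u w generalizing u with
  | zero =>
    obtain rfl : u = w := hG.connected.dist_eq_zero_iff.1 hk
    have := hG.connected.dist_triangle (u := a) (v := u) (w := b)
    rw [dist_comm (u := a) (v := u)] at this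
    omega
  | succ k ih =>
    have hne : u ≠ w := by rintro rfl; simp at hk
    obtain ⟨v, huv, hv⟩ := hG.connected.exists_adj_dist_add_one_eq hne
    have key := ih v (by omega)
    -- An endpoint on the side of `u` of the edge `uv` sees `w` only through `u`.
    have side : ∀ y, G.dist u y = G.dist v y + 1 ∨ G.dist w y = G.dist u y + G.dist u w := by
      intro y
      rcases hG.dist_eq_dist_add_one_of_adj y huv with h | h
      · left; rw [dist_comm, h, dist_comm]
      · right
        rw [dist_comm, hG.dist_eq_add_of_adj huv h hv.symm, dist_comm (u := y)]
        omega
    have t := hG.connected.dist_triangle (u := a) (v := u) (w := b)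
    rw [dist_comm (u := a) (v := u)] at t
    rcases side a with ha | ha
    · rcases side b with hb | hb <;> omega
    · omega

lemma IsTree.dist_add_mod_two (hG : G.IsTree) (u v w : V) :
    (G.dist u v + G.dist v w + G.dist u w) % 2 = 0 := by
  induction hk : G.dist v w generalizing v with
  | zero =>
    obtain rfl : v = w := hG.connected.dist_eq_zero_iff.1 hk
    omega
  | succ k ih =>
    have hne : v ≠ w := by rintro rfl; simp at hk
    obtain ⟨x, hvx, hx⟩ := hG.connected.exists_adj_dist_add_one_eq hne
    have h1 := ih x (by omega)
    rcases hG.dist_eq_dist_add_one_of_adj u hvx with h | h <;> omega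

lemma Connected.dist_le_diam [Finite V] (hG : G.Connected) (u v : V) : G.dist u v ≤ G.diam := by
  have := hG.nonempty
  exact SimpleGraph.dist_le_diam (connected_iff_ediam_ne_top.1 hG)

/-- In a tree, a pair of vertices whose distance is less than the diameter extends, at one of its
two ends, to a pair at distance one larger. -/
lemma IsTree.exists_dist_eq_add_one [Finite V] (hG : G.IsTree) (h : G.dist u w < G.diam) :
    (∃ x, G.dist u x = G.dist u w + 1) ∨ ∃ x, G.dist w x = G.dist u w + 1 := by
  have := hG.connected.nonempty
  obtain ⟨a, b, hab⟩ := G.exists_dist_eq_diam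
  have h4 := hG.dist_add_dist_le u w a b
  have ext : ∀ z y, G.dist u w + 1 ≤ G.dist z y → ∃ x, G.dist z x = G.dist u w + 1 :=
    fun z y hzy ↦ (hG.connected.exists_dist_eq_and_dist_eq_sub hzy).imp fun _ h ↦ h.1
  by_cases h1 : G.dist u w + 1 ≤ G.dist u a
  · exact .inl (ext _ _ h1)
  by_cases h2 : G.dist u w + 1 ≤ G.dist u b
  · exact .inl (ext _ _ h2)
  by_cases h3 : G.dist u w + 1 ≤ G.dist w a
  · exact .inr (ext _ _ h3)
  · exact .inr (ext w b (by omega))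

/-! ### Counting pairs at a given distance -/

section Count

variable [Fintype V]

/-- The vertices at distance exactly `i` from `v`. -/
noncomputable def distSphere (G : SimpleGraph V) (v : V) (i : ℕ) : Finset V :=
  {w | G.dist v w = i}

/-- The ordered pairs of vertices at distance exactly `i`. -/
noncomputable def distPairs (G : SimpleGraph V) (i : ℕ) : Finset (V × V) :=
  {p | G.dist p.1 p.2 = i}

@[simp] lemma mem_distSphere : w ∈ G.distSphere v i ↔ G.dist v w = i := by simp [distSphere]

@[simp] lemma mem_distPairs {p : V × V} : p ∈ G.distPairs i ↔ G.dist p.1 p.2 = i := by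
  simp [distPairs]

lemma card_distPairs (G : SimpleGraph V) (i : ℕ) :
    (G.distPairs i).card = ∑ v, (G.distSphere v i).card := by
  simp only [distPairs, distSphere, Finset.card_filter]
  rw [Fintype.sum_prod_type]

lemma two_mul_numPairsAtDist (G : SimpleGraph V) (hi : i ≠ 0) :
    2 * G.numPairsAtDist i = (G.distPairs i).card := by
  classical
  let H : SimpleGraph V :=
    { Adj := fun u v ↦ G.dist u v = i
      symm := ⟨fun u v h ↦ by rwa [dist_comm]⟩
      loopless := ⟨fun u h ↦ hi (by rw [← h, dist_self])⟩ }
  have h1 : G.numPairsAtDist i = H.edgeFinset.card := by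
    rw [numPairsAtDist, ← Set.ncard_coe_finset, coe_edgeFinset]
    congr 1
    ext e
    induction e with
    | _ u v =>
      simp only [Set.mem_ofPred_eq, mem_edgeSet, H]
      constructor
      · rintro ⟨a, b, hab, h⟩
        rcases Sym2.eq_iff.1 hab with ⟨rfl, rfl⟩ | ⟨rfl, rfl⟩
        · exact h
        · rwa [dist_comm]
      · exact fun h ↦ ⟨u, v, rfl, h⟩
  rw [h1, ← H.sum_degrees_eq_twice_card_edges, card_distPairs]
  refine Finset.sum_congr rfl fun v _ ↦ ?_
  rw [← card_neighborFinset_eq_degree]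
  congr 1
  ext w
  simp [H]

lemma Connected.numPairsAtDist_pos (hG : G.Connected) (hi : i ≠ 0) (h : i ≤ G.diam) :
    0 < G.numPairsAtDist i := by
  have := hG.nonempty
  obtain ⟨a, b, hab⟩ := G.exists_dist_eq_diam
  obtain ⟨x, hx, -⟩ := hG.exists_dist_eq_and_dist_eq_sub (h.trans_eq hab.symm)
  have h1 : 0 < (G.distPairs i).card := Finset.card_pos.2 ⟨(a, x), by simpa using hx⟩
  have := G.two_mul_numPairsAtDist hi
  omega

/-- Distinct distances give disjoint sets of pairs. -/
lemma sum_card_distPairs_le (G : SimpleGraph V) (s : Finset ℕ) :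
    ∑ i ∈ s, (G.distPairs i).card ≤ Fintype.card V ^ 2 := by
  classical
  rw [← Finset.card_biUnion]
  · refine (Finset.card_le_univ _).trans_eq ?_
    rw [Fintype.card_prod, sq]
  · intro i _ j _ hij
    rw [Function.onFun, Finset.disjoint_left]
    intro p hp hq
    rw [mem_distPairs] at hp hq
    exact hij (hp.symm.trans hq)

/-- The number of vertices at distance `i` from `v` per vertex at distance `i + 1`; it is `0`
if there is no vertex at distance `i + 1`. -/
noncomputable def sphereRatio (G : SimpleGraph V) (i : ℕ) (v : V) : ℝ :=
  (G.distSphere v i).card / (G.distSphere v (i + 1)).card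

/-- Every pair at distance `i` below the diameter has an end `u` with `ecc u > i`; distributing it
evenly over the pairs at distance `i + 1` with end `u` bounds the ratio of consecutive
coefficients by a maximum over pairs at distance `i + 1`. -/
lemma IsTree.numPairsAtDist_le_mul (hG : G.IsTree) (hi : i ≠ 0) (hd : i < G.diam) {R : ℝ}
    (hR : ∀ u x, G.dist u x = i + 1 → G.sphereRatio i u + G.sphereRatio i x ≤ R) :
    (G.numPairsAtDist i : ℝ) ≤ R * G.numPairsAtDist (i + 1) := by
  classical
  set S : Finset V := {u | (G.distSphere u (i + 1)).Nonempty} with hS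
  -- pairs with first end in `S`, and pairs with second end in `S`, cover everything
  have h1 : (G.distPairs i).card ≤ 2 * ∑ u ∈ S, (G.distSphere u i).card := by
    have hcov : G.distPairs i ⊆
        (S.sigma fun u ↦ G.distSphere u i).image (fun p ↦ (p.1, p.2)) ∪
        (S.sigma fun u ↦ G.distSphere u i).image (fun p ↦ (p.2, p.1)) := by
      rintro ⟨u, w⟩ hp
      rw [mem_distPairs] at hp
      simp only at hp
      rw [← hp] at hd
      rw [Finset.mem_union, Finset.mem_image, Finset.mem_image]
      rcases hG.exists_dist_eq_add_one hd with ⟨x, hx⟩ | ⟨x, hx⟩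
      · refine .inl ⟨⟨u, w⟩, ?_, rfl⟩
        rw [hp] at hx
        simpa [hS, hp] using ⟨x, mem_distSphere.2 hx⟩
      · refine .inr ⟨⟨w, u⟩, ?_, rfl⟩
        rw [hp] at hx
        simpa [hS, dist_comm, hp] using ⟨x, mem_distSphere.2 hx⟩
    calc (G.distPairs i).card ≤ _ := Finset.card_le_card hcov
      _ ≤ _ := Finset.card_union_le _ _
      _ ≤ (S.sigma fun u ↦ G.distSphere u i).card + (S.sigma fun u ↦ G.distSphere u i).card :=
        add_le_add Finset.card_image_le Finset.card_image_le
      _ = _ := by rw [Finset.card_sigma, two_mul]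
  have h2 : ∑ u ∈ S, ((G.distSphere u i).card : ℝ) ≤
      ∑ u, ∑ x ∈ G.distSphere u (i + 1), G.sphereRatio i u := by
    have hnn : ∀ u, 0 ≤ ∑ x ∈ G.distSphere u (i + 1), G.sphereRatio i u := fun u ↦
      Finset.sum_nonneg fun x _ ↦ by unfold sphereRatio; positivity
    refine le_trans (Finset.sum_le_sum fun u hu ↦ ?_)
      (Finset.sum_le_sum_of_subset_of_nonneg (Finset.subset_univ S) fun u _ _ ↦ hnn u)
    rw [Finset.sum_const, nsmul_eq_mul, sphereRatio, mul_div_cancel₀]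
    have : (G.distSphere u (i + 1)).Nonempty := by simpa [hS] using hu
    exact_mod_cast this.card_pos.ne'
  have h3 : ∑ u, ∑ x ∈ G.distSphere u (i + 1), G.sphereRatio i u =
      ∑ u, ∑ x ∈ G.distSphere u (i + 1), G.sphereRatio i x := by
    simp only [distSphere, Finset.sum_filter]
    rw [Finset.sum_comm]
    refine Finset.sum_congr rfl fun u _ ↦ Finset.sum_congr rfl fun x _ ↦ ?_
    rw [dist_comm]
  have h4 : ∑ u, ∑ x ∈ G.distSphere u (i + 1), (G.sphereRatio i u + G.sphereRatio i x) ≤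
      R * (G.distPairs (i + 1)).card := by
    rw [card_distPairs, Nat.cast_sum, Finset.mul_sum]
    refine Finset.sum_le_sum fun u _ ↦ ?_
    rw [mul_comm, ← nsmul_eq_mul]
    exact Finset.sum_le_card_nsmul _ _ _ fun x hx ↦ hR u x (mem_distSphere.1 hx)
  simp only [Finset.sum_add_distrib] at h4
  rw [← h3] at h4
  have h5 : ((G.distPairs i).card : ℝ) ≤ 2 * ∑ u ∈ S, ((G.distSphere u i).card : ℝ) := by
    exact_mod_cast h1
  rw [← two_mul_numPairsAtDist G hi] at h5
  rw [← two_mul_numPairsAtDist G i.succ_ne_zero] at h4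
  push_cast at h4 h5
  linarith

end Count

end SimpleGraph

/-! ### Bounds on the moduli of roots -/

/-- The Eneström–Kakeya bound: the roots of a polynomial with positive coefficients have modulus at
most the largest ratio of consecutive coefficients. -/
lemma norm_le_of_sum_mul_pow_eq_zero {c : ℕ → ℝ} {D : ℕ} (hD : D ≠ 0) {R : ℝ} (hR : 0 ≤ R)
    (hc : ∀ i < D, 0 < c i) (h : ∀ i, i + 1 < D → c i ≤ R * c (i + 1)) {z : ℂ}
    (hz : ∑ i ∈ Finset.range D, (c i : ℂ) * z ^ i = 0) : ‖z‖ ≤ R := by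
  by_contra! hlt
  obtain ⟨m, rfl⟩ := Nat.exists_eq_succ_of_ne_zero hD
  set Q : ℕ → ℂ := fun k ↦ ∑ i ∈ Finset.range (k + 1), (c i : ℂ) * z ^ i with hQ
  set q : ℕ → ℝ := fun k ↦ ∑ i ∈ Finset.range (k + 1), c i * ‖z‖ ^ i with hq
  -- Multiplying by `z - R` makes all coefficients but the leading one nonpositive.
  have key : ∀ k < m + 1, ‖(z - R) * Q k - c k * z ^ (k + 1)‖ ≤
      c k * ‖z‖ ^ (k + 1) - (‖z‖ - R) * q k := by
    intro k hk
    induction k with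
    | zero =>
      have h0 : (z - R) * Q 0 - c 0 * z ^ (0 + 1) = -((R * c 0 : ℝ) : ℂ) := by
        simp only [hQ, zero_add, Finset.sum_range_one]
        push_cast
        ring
      rw [h0, norm_neg, Complex.norm_real, Real.norm_of_nonneg (mul_nonneg hR (hc 0 hk).le)]
      simp only [hq, zero_add, Finset.sum_range_one]
      apply le_of_eq
      ring
    | succ k ih =>
      have hQs : Q (k + 1) = Q k + c (k + 1) * z ^ (k + 1) := Finset.sum_range_succ _ _
      have hqs : q (k + 1) = q k + c (k + 1) * ‖z‖ ^ (k + 1) := Finset.sum_range_succ _ _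
      have e : (z - R) * Q (k + 1) - c (k + 1) * z ^ (k + 1 + 1) =
          ((z - R) * Q k - c k * z ^ (k + 1)) - ((R * c (k + 1) - c k : ℝ) : ℂ) * z ^ (k + 1) := by
        rw [hQs]; push_cast; ring
      have hn : ‖((R * c (k + 1) - c k : ℝ) : ℂ) * z ^ (k + 1)‖ =
          (R * c (k + 1) - c k) * ‖z‖ ^ (k + 1) := by
        rw [norm_mul, norm_pow, Complex.norm_real,
          Real.norm_of_nonneg (sub_nonneg.2 (h k (by omega)))]
      rw [e, hqs]
      refine (norm_sub_le _ _).trans ?_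
      rw [hn]
      have := ih (by omega)
      calc _ ≤ _ := add_le_add_left this _
        _ = _ := by ring
  have hm := key m (by omega)
  have hQm : Q m = 0 := hz
  rw [hQm, mul_zero, zero_sub, norm_neg, norm_mul, norm_pow, Complex.norm_real,
    Real.norm_of_nonneg (hc m (by omega)).le] at hm
  have hpos : 0 < q m := by
    refine Finset.sum_pos (fun i hi ↦ ?_) ⟨0, by simp⟩
    have := hc i (Finset.mem_range.1 hi)
    have : 0 < ‖z‖ := hR.trans_lt hlt
    positivity
  nlinarith [mul_pos (sub_pos.2 hlt) hpos]

/-- A real quadratic with two nonpositive real roots is smallest in modulus, on a circle around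
zero, at the negative real point, up to sign. -/
lemma norm_sq_sub_mul_add_le {a b : ℝ} (ha : 0 ≤ a) (hb : 0 ≤ b) (hab : 4 * b ≤ a ^ 2) (z : ℂ) :
    ‖z‖ ^ 2 - a * ‖z‖ + b ≤ ‖z ^ 2 + a * z + b‖ := by
  set t := √(a ^ 2 - 4 * b) with ht
  have ht2 : t ^ 2 = a ^ 2 - 4 * b := Real.sq_sqrt (by linarith)
  have ht0 : 0 ≤ t := Real.sqrt_nonneg _
  have hta : t ≤ a := abs_le_of_sq_le_sq' (by linarith) ha |>.2
  have hs : ∀ s : ℝ, 0 ≤ s → |‖z‖ - s| ≤ ‖z + s‖ := by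
    intro s hs
    have := abs_norm_sub_norm_le z (-(s : ℂ))
    rwa [norm_neg, Complex.norm_real, Real.norm_of_nonneg hs, sub_neg_eq_add] at this
  have hb' : b = (a + t) / 2 * ((a - t) / 2) := by linarith
  have e1 : z ^ 2 + a * z + b = (z + ((a + t) / 2 : ℝ)) * (z + ((a - t) / 2 : ℝ)) := by
    rw [hb']; push_cast; ring
  have e2 : ‖z‖ ^ 2 - a * ‖z‖ + b = (‖z‖ - (a + t) / 2) * (‖z‖ - (a - t) / 2) := by
    rw [hb']; ring
  rw [e1, e2, norm_mul]
  refine (le_abs_self _).trans ?_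
  rw [abs_mul]
  exact mul_le_mul (hs _ (by linarith)) (hs _ (by linarith)) (abs_nonneg _) (norm_nonneg _)

/-- A root `z` of a monic polynomial with nonnegative coefficients, in terms of its three leading
coefficients and the sum of the others. -/
lemma norm_mul_sq_sub_le_of_sum_eq_zero {c : ℕ → ℝ} {m : ℕ} (hm : m ≠ 0) (hc : ∀ i, 0 ≤ c i)
    (hlead : c (m + 2) = 1) (hdisc : 4 * c m ≤ c (m + 1) ^ 2) {z : ℂ} (hz1 : 1 ≤ ‖z‖)
    (hz : ∑ i ∈ Finset.range (m + 3), (c i : ℂ) * z ^ i = 0) :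
    ‖z‖ * (‖z‖ ^ 2 - c (m + 1) * ‖z‖ + c m) ≤ ∑ i ∈ Finset.range m, c i := by
  obtain ⟨k, rfl⟩ := Nat.exists_eq_succ_of_ne_zero hm
  rw [Finset.sum_range_succ, Finset.sum_range_succ, Finset.sum_range_succ, hlead] at hz
  have e : z ^ (k + 1) * (z ^ 2 + c (k + 1 + 1) * z + c (k + 1)) =
      -∑ i ∈ Finset.range (k + 1), (c i : ℂ) * z ^ i := by
    rw [eq_neg_iff_add_eq_zero, ← hz]
    push_cast
    ring
  have h1 : ‖z‖ ^ (k + 1) * (‖z‖ ^ 2 - c (k + 1 + 1) * ‖z‖ + c (k + 1)) ≤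
      ∑ i ∈ Finset.range (k + 1), c i * ‖z‖ ^ k := by
    calc _ ≤ ‖z‖ ^ (k + 1) * ‖z ^ 2 + c (k + 1 + 1) * z + c (k + 1)‖ := by
          gcongr
          exact norm_sq_sub_mul_add_le (hc _) (hc _) hdisc z
      _ = ‖∑ i ∈ Finset.range (k + 1), (c i : ℂ) * z ^ i‖ := by
          rw [← norm_pow, ← norm_mul, e, norm_neg]
      _ ≤ ∑ i ∈ Finset.range (k + 1), c i * ‖z‖ ^ k := by
          refine norm_sum_le_of_le _ fun i hi ↦ ?_
          rw [norm_mul, norm_pow, Complex.norm_real, Real.norm_of_nonneg (hc i)]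
          have := hc i
          have : i ≤ k := Nat.lt_succ_iff.1 (Finset.mem_range.1 hi)
          gcongr
  rw [← Finset.sum_mul] at h1
  have hp : 0 < ‖z‖ ^ k := by positivity
  refine le_of_mul_le_mul_right ?_ hp
  calc _ = _ := by ring
    _ ≤ _ := h1

/-- A quintic with a large coefficient of `x ^ 4` has a root to the left of `-(2 * n - 16)`. -/
lemma exists_lt_quintic_eq_zero {n a b c d e : ℝ} (hn : 31 ≤ n) (ha : 2 * n - 14 ≤ a)
    (hb0 : 0 ≤ b) (hb : b ≤ 2 * n + 16) (hc : 0 ≤ c) (hd0 : 0 ≤ d) (hd : d ≤ n ^ 2) (he : 0 ≤ e) :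
    ∃ x < -(2 * n - 16), e + d * x + c * x ^ 2 + b * x ^ 3 + a * x ^ 4 + x ^ 5 = 0 := by
  set f : ℝ → ℝ := fun x ↦ e + d * x + c * x ^ 2 + b * x ^ 3 + a * x ^ 4 + x ^ 5 with hf
  have hcont : Continuous f := by fun_prop
  obtain ⟨r, rfl⟩ : ∃ r, n = (r + 16) / 2 := ⟨2 * n - 16, by ring⟩
  have hr : 46 ≤ r := by linarith
  have hpos : 0 < f (-r) := by
    have h1 : (r + 2) * r ^ 4 ≤ a * r ^ 4 := by gcongr; linarith
    have h2 : b * r ^ 3 ≤ (r + 32) * r ^ 3 := by gcongr; linarith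
    have h3 : d * r ≤ r ^ 2 * r := by gcongr; nlinarith
    have h4 : 46 * r ^ 3 ≤ r * r ^ 3 := by gcongr
    have h5 : 0 < r ^ 3 := by positivity
    have h6 : 0 ≤ c * r ^ 2 := by positivity
    simp only [hf]
    nlinarith
  set R := a + c + e with hRdef
  have hRr : r + 2 ≤ R := by linarith
  have hneg : f (-R) ≤ 0 := by
    have hR1 : 1 ≤ R := by linarith
    have h1 : c * R ^ 2 ≤ c * R ^ 4 := by gcongr; norm_num
    have h2 : e * 1 ≤ e * R ^ 4 := by gcongr; exact one_le_pow₀ hR1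
    have h3 : 0 ≤ b * R ^ 3 := by positivity
    have h4 : 0 ≤ d * R := by positivity
    have h5 : R ^ 5 = a * R ^ 4 + c * R ^ 4 + e * R ^ 4 := by
      rw [show R ^ 5 = R * R ^ 4 by ring]; nth_rw 1 [hRdef]; ring
    simp only [hf]
    nlinarith
  obtain ⟨x, hx, hx0⟩ := intermediate_value_Icc (show -R ≤ -r by linarith)
    hcont.continuousOn ⟨hneg, hpos.le⟩
  refine ⟨x, ?_, hx0⟩
  rcases hx.2.lt_or_eq with h | h
  · linarith
  · rw [h] at hx0; linarith

namespace SimpleGraph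

variable {V : Type*} {G : SimpleGraph V}

lemma isWienerRoot_iff {z : ℂ} : G.IsWienerRoot z ↔
    ∑ i ∈ Finset.range G.diam, ((G.numPairsAtDist (i + 1) : ℝ) : ℂ) * z ^ i = 0 := by
  have h : G.reducedWienerPoly = ∑ i ∈ Finset.range G.diam,
      Polynomial.C (G.numPairsAtDist (i + 1) : ℂ) * Polynomial.X ^ i := by
    apply mul_right_cancel₀ (Polynomial.X_ne_zero (R := ℂ))
    rw [reducedWienerPoly_mul_X, wienerPoly, Finset.sum_mul]
    rw [← Finset.Ico_add_one_right_eq_Icc, Finset.sum_Ico_eq_sum_range]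
    refine Finset.sum_congr (by simp) fun i _ ↦ ?_
    rw [add_comm 1 i, mul_assoc, ← pow_succ]
  rw [IsWienerRoot, h, Polynomial.IsRoot.def, Polynomial.eval_finsetSum]
  simp

/-! ### Pairs with large ratios of sphere sizes -/

section Ratio

variable [Fintype V]

lemma Connected.card_distSphere_add_card_distSphere_succ_le (hG : G.Connected)
    (h : G.dist u x = i + 1) :
    (G.distSphere u i).card + (G.distSphere u (i + 1)).card + i ≤ Fintype.card V := by
  classical
  have h1 : ∑ j ∈ Finset.range (i + 2), (G.distSphere u j).card ≤ Fintype.card V := by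
    rw [← Finset.card_biUnion]
    · exact Finset.card_le_univ _
    · intro j _ k _ hjk
      rw [Function.onFun, Finset.disjoint_left]
      intro w hj hk
      rw [mem_distSphere] at hj hk
      exact hjk (hj.symm.trans hk)
  have h2 : ∑ j ∈ Finset.range i, 1 ≤ ∑ j ∈ Finset.range i, (G.distSphere u j).card := by
    refine Finset.sum_le_sum fun j hj ↦ Finset.card_pos.2 ?_
    rw [Finset.mem_range] at hj
    obtain ⟨y, hy, -⟩ := hG.exists_dist_eq_and_dist_eq_sub (show j ≤ G.dist u x by omega)
    exact ⟨y, mem_distSphere.2 hy⟩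
  rw [Finset.sum_range_succ, Finset.sum_range_succ] at h1
  rw [Finset.sum_const, Finset.card_range, smul_eq_mul, mul_one] at h2
  omega

/-- Spheres of even radius around the ends of a path of odd length are disjoint, by parity; for
radius `1` they share at most the midpoint. -/
lemma IsTree.card_distSphere_add_card_distSphere_le (hG : G.IsTree) (h : G.dist u x = i + 1)
    (hi : i % 2 = 0 ∨ i = 1) :
    (G.distSphere u i).card + (G.distSphere x i).card ≤ Fintype.card V + 1 := by
  classical
  rw [← Finset.card_union_add_card_inter]
  refine add_le_add (Finset.card_le_univ _) (Finset.card_le_one.2 fun w hw w' hw' ↦ ?_)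
  simp only [Finset.mem_inter, mem_distSphere] at hw hw'
  have h1 := hG.dist_add_mod_two u w x
  have h2 := hG.dist_add_dist_le w w' u x
  rw [dist_comm (u := w) (v := x)] at h1
  rw [dist_comm (u := w) (v := u), dist_comm (u := w) (v := x), dist_comm (u := w') (v := u),
    dist_comm (u := w') (v := x)] at h2
  rcases hi with hi | rfl
  · omega
  · exact hG.connected.dist_eq_zero_iff.1 (by omega)

lemma sphereRatio_le (h : G.dist u x = i + 1) : G.sphereRatio i u ≤ (G.distSphere u i).card := by
  refine div_le_self (by positivity) ?_
  exact_mod_cast Finset.card_pos.2 ⟨x, mem_distSphere.2 h⟩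

lemma Connected.sphereRatio_le_half (hG : G.Connected) (h : G.dist u x = i + 1)
    (h1 : (G.distSphere u (i + 1)).card ≠ 1) :
    G.sphereRatio i u ≤ ((Fintype.card V : ℝ) - i - 2) / 2 := by
  have h2 : 0 < (G.distSphere u (i + 1)).card := Finset.card_pos.2 ⟨x, mem_distSphere.2 h⟩
  have h3 := hG.card_distSphere_add_card_distSphere_succ_le h
  have h4 : ((G.distSphere u i).card : ℝ) + (G.distSphere u (i + 1)).card + i ≤
      Fintype.card V := by exact_mod_cast h3
  have h5 : (2 : ℝ) ≤ (G.distSphere u (i + 1)).card := by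
    exact_mod_cast (show 2 ≤ (G.distSphere u (i + 1)).card by omega)
  calc G.sphereRatio i u ≤ (G.distSphere u i).card / 2 := by
        unfold sphereRatio; gcongr
    _ ≤ _ := by linarith

/-- The pairs at distance `i + 1` at which the ratio of consecutive coefficients can exceed
`2 * n - 16`. -/
lemma IsTree.of_lt_sphereRatio_add (hG : G.IsTree) (hn : 31 ≤ Fintype.card V)
    (hux : G.dist u x = i + 1)
    (hlt : 2 * (Fintype.card V : ℝ) - 16 < G.sphereRatio i u + G.sphereRatio i x) :
    (i = 3 ∨ i = 5) ∧ (G.distSphere u (i + 1)).card = 1 ∧ (G.distSphere x (i + 1)).card = 1 ∧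
      2 * Fintype.card V ≤ (G.distSphere u i).card + (G.distSphere x i).card + 15 := by
  have hxu : G.dist x u = i + 1 := by rwa [dist_comm]
  have hu := hG.connected.card_distSphere_add_card_distSphere_succ_le hux
  have hx := hG.connected.card_distSphere_add_card_distSphere_succ_le hxu
  have hu1 : 0 < (G.distSphere u (i + 1)).card := Finset.card_pos.2 ⟨x, mem_distSphere.2 hux⟩
  have hx1 : 0 < (G.distSphere x (i + 1)).card := Finset.card_pos.2 ⟨u, mem_distSphere.2 hxu⟩
  have hru := sphereRatio_le hux
  have hrx := sphereRatio_le hxu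
  have hsum : 2 * Fintype.card V ≤ (G.distSphere u i).card + (G.distSphere x i).card + 15 := by
    have : (2 * Fintype.card V : ℝ) <
        (((G.distSphere u i).card + (G.distSphere x i).card + 16 : ℕ) : ℝ) := by
      push_cast; linarith
    have : 2 * Fintype.card V < (G.distSphere u i).card + (G.distSphere x i).card + 16 := by
      exact_mod_cast this
    omega
  have hi : i = 3 ∨ i = 5 := by
    by_contra hi
    by_cases hpar : i % 2 = 0 ∨ i = 1
    · have := hG.card_distSphere_add_card_distSphere_le hux hpar
      omega
    · omega
  have hi3 : (3 : ℝ) ≤ i := by exact_mod_cast (show 3 ≤ i by omega)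
  have hn' : (31 : ℝ) ≤ Fintype.card V := by exact_mod_cast hn
  have hu' : ((G.distSphere u i).card : ℝ) + 1 + i ≤ Fintype.card V := by
    exact_mod_cast (show (G.distSphere u i).card + 1 + i ≤ Fintype.card V by omega)
  have hx' : ((G.distSphere x i).card : ℝ) + 1 + i ≤ Fintype.card V := by
    exact_mod_cast (show (G.distSphere x i).card + 1 + i ≤ Fintype.card V by omega)
  refine ⟨hi, ?_, ?_, hsum⟩
  · by_contra h1
    have := hG.connected.sphereRatio_le_half hux h1
    linarith
  · by_contra h1
    have := hG.connected.sphereRatio_le_half hxu h1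
    linarith

end Ratio

/-! ### Trees with an extremal pair at distance four -/

section Four

variable [Fintype V]

lemma card_distSphere_add_le_numPairsAtDist (hux : u ≠ x) (hi : G.dist u x ≠ i) :
    (G.distSphere u i).card + (G.distSphere x i).card ≤ G.numPairsAtDist i := by
  classical
  have hinj : ∀ v : V, Function.Injective fun w ↦ s(v, w) := fun v w w' h ↦ Sym2.congr_right.1 h
  have hdisj : Disjoint ((G.distSphere u i).image fun w ↦ s(u, w))
      ((G.distSphere x i).image fun w ↦ s(x, w)) := by
    rw [Finset.disjoint_left]
    intro e he he'
    rw [Finset.mem_image] at he he'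
    obtain ⟨w, hw, rfl⟩ := he
    obtain ⟨w', hw', h⟩ := he'
    rcases Sym2.eq_iff.1 h with ⟨h1, -⟩ | ⟨h1, -⟩
    · exact hux h1.symm
    · rw [mem_distSphere, ← h1] at hw
      exact hi hw
  rw [← Finset.card_image_of_injective _ (hinj u), ← Finset.card_image_of_injective _ (hinj x),
    ← Finset.card_union_of_disjoint hdisj, numPairsAtDist, ← Set.ncard_coe_finset]
  refine Set.ncard_le_ncard ?_ (Set.toFinite _)
  intro e he
  rw [Finset.mem_coe, Finset.mem_union, Finset.mem_image, Finset.mem_image] at he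
  rcases he with ⟨w, hw, rfl⟩ | ⟨w, hw, rfl⟩
  · exact ⟨u, w, rfl, mem_distSphere.1 hw⟩
  · exact ⟨x, w, rfl, mem_distSphere.1 hw⟩

lemma numPairsAtDist_le_card_distSphere_add
    (h : ∀ a b, G.dist a b = i → a = u ∨ a = x ∨ b = u ∨ b = x) :
    G.numPairsAtDist i ≤ (G.distSphere u i).card + (G.distSphere x i).card := by
  classical
  have hsub : {e : Sym2 V | ∃ a b : V, e = s(a, b) ∧ G.dist a b = i} ⊆
      (((G.distSphere u i).image fun w ↦ s(u, w)) ∪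
        ((G.distSphere x i).image fun w ↦ s(x, w)) : Finset (Sym2 V)) := by
    rintro e ⟨a, b, rfl, hab⟩
    simp only [Finset.coe_union, Finset.coe_image, Set.mem_union, Set.mem_image, Finset.mem_coe,
      mem_distSphere]
    rcases h a b hab with rfl | rfl | rfl | rfl
    · exact .inl ⟨b, hab, rfl⟩
    · exact .inr ⟨b, hab, rfl⟩
    · exact .inl ⟨a, by rwa [dist_comm], Sym2.eq_swap⟩
    · exact .inr ⟨a, by rwa [dist_comm], Sym2.eq_swap⟩
  refine (Set.ncard_le_ncard hsub (Finset.finite_toSet _)).trans ?_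
  rw [Set.ncard_coe_finset]
  exact (Finset.card_union_le _ _).trans (add_le_add Finset.card_image_le Finset.card_image_le)

lemma Connected.diam_eq_two_mul (hG : G.Connected) (hc : ∀ y, G.dist c y ≤ k)
    (hux : G.dist u x = 2 * k) : G.diam = 2 * k := by
  have := hG.nonempty
  obtain ⟨a, b, hab⟩ := G.exists_dist_eq_diam
  have h1 := hG.dist_le_diam u x
  have h2 := hG.dist_triangle (u := a) (v := c) (w := b)
  rw [dist_comm (u := a) (v := c)] at h2
  have := hc a
  have := hc b
  omega

lemma Connected.numPairsAtDist_two_mul_eq_one (hG : G.Connected) (hk : k ≠ 0)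
    (hc : ∀ y, G.dist c y ≤ k) (hck : ∀ y, G.dist c y = k → y = u ∨ y = x)
    (hux : G.dist u x = 2 * k) : G.numPairsAtDist (2 * k) = 1 := by
  classical
  have h1 : G.distPairs (2 * k) ⊆ {(u, x), (x, u)} := by
    rintro ⟨a, b⟩ h
    rw [mem_distPairs] at h
    simp only at h
    have hab := hG.dist_triangle (u := a) (v := c) (w := b)
    rw [dist_comm (u := a) (v := c)] at hab
    have ha := hc a
    have hb := hc b
    have hne : a ≠ b := by rintro rfl; simp at h; omega
    simp only [Finset.mem_insert, Finset.mem_singleton, Prod.mk.injEq]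
    rcases hck a (by omega) with rfl | rfl <;> rcases hck b (by omega) with rfl | rfl <;>
      simp_all
  have h2 := (Finset.card_le_card h1).trans Finset.card_le_two
  rw [← two_mul_numPairsAtDist G (by omega)] at h2
  have := hG.numPairsAtDist_pos (i := 2 * k) (by omega) (hG.diam_eq_two_mul hc hux).ge
  omega

lemma Connected.numPairsAtDist_le_of_add_one_eq (hG : G.Connected)
    (hc : ∀ y, G.dist c y ≤ k) (hck : ∀ y, G.dist c y = k → y = u ∨ y = x)
    (hi : i + 1 = 2 * k) :
    G.numPairsAtDist i ≤ (G.distSphere u i).card + (G.distSphere x i).card := by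
  refine numPairsAtDist_le_card_distSphere_add fun a b h ↦ ?_
  have hab := hG.dist_triangle (u := a) (v := c) (w := b)
  rw [dist_comm (u := a) (v := c)] at hab
  have ha := hc a
  have hb := hc b
  by_cases hak : G.dist c a = k
  · exact (hck a hak).imp id .inl
  · exact .inr (.inr (hck b (by omega)))

/-- A vertex far from the centre `c` is at distance four from almost all neighbours of `c`, so that
`d_4` is large. -/
lemma IsTree.numPairsAtDist_three_le (hG : G.IsTree) (hn : 31 ≤ Fintype.card V)
    {M : Finset V} (hM : ∀ w ∈ M, G.dist c w = 1) (hMn : Fintype.card V ≤ M.card + 12)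
    (hy : 3 ≤ G.dist c y) :
    (G.numPairsAtDist 3 : ℝ) ≤ (2 * Fintype.card V - 16) * G.numPairsAtDist 4 := by
  classical
  obtain ⟨y, hy, -⟩ := hG.connected.exists_dist_eq_and_dist_eq_sub hy
  have h1 : (M.filter fun w ↦ G.dist y w ≠ 4).card ≤ 1 := by
    have h2 : ∀ w ∈ M.filter fun w ↦ G.dist y w ≠ 4, G.dist y w = 2 := by
      intro w hw
      rw [Finset.mem_filter] at hw
      have := hM w hw.1
      have h1 := hG.dist_add_mod_two c y w
      have h2 := hG.connected.dist_triangle (u := y) (v := c) (w := w)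
      have h3 := hG.connected.dist_triangle (u := c) (v := w) (w := y)
      rw [dist_comm (u := y) (v := c)] at h2
      rw [dist_comm (u := w) (v := y)] at h3
      omega
    refine Finset.card_le_one.2 fun w hw w' hw' ↦ ?_
    have h3 := h2 w hw
    have h4 := h2 w' hw'
    have h5 := hM w (Finset.mem_filter.1 hw).1
    have h6 := hM w' (Finset.mem_filter.1 hw').1
    have h7 := hG.dist_add_dist_le c y w w'
    exact hG.connected.dist_eq_zero_iff.1 (by omega)
  have h2 : M.card ≤ (G.distPairs 4).card + 1 := by
    rw [← Finset.card_filter_add_card_filter_not (fun w ↦ G.dist y w = 4)]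
    refine add_le_add ?_ h1
    rw [card_distPairs]
    refine le_trans (Finset.card_le_card fun w hw ↦ ?_)
      (Finset.single_le_sum (fun v _ ↦ Nat.zero_le (G.distSphere v 4).card) (Finset.mem_univ y))
    exact mem_distSphere.2 (Finset.mem_filter.1 hw).2
  have h3 : (G.distPairs 3).card + M.card ^ 2 ≤ Fintype.card V ^ 2 := by
    have hdisj : Disjoint (G.distPairs 3) (M ×ˢ M) := by
      rw [Finset.disjoint_left]
      rintro ⟨w, w'⟩ hw hw'
      rw [mem_distPairs] at hw
      rw [Finset.mem_product] at hw'
      have h1 := hM w hw'.1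
      have h2 := hM w' hw'.2
      have h3 := hG.connected.dist_triangle (u := w) (v := c) (w := w')
      rw [dist_comm (u := w) (v := c)] at h3
      simp only at hw h1 h2
      omega
    rw [sq, ← Finset.card_product, ← Finset.card_union_of_disjoint hdisj, sq,
      ← Fintype.card_prod]
    exact Finset.card_le_univ _
  rw [← two_mul_numPairsAtDist G (by norm_num)] at h2 h3
  have hn' : (31 : ℝ) ≤ Fintype.card V := by exact_mod_cast hn
  have hMn' : (Fintype.card V : ℝ) ≤ M.card + 12 := by exact_mod_cast hMn
  have h2' : (M.card : ℝ) ≤ 2 * G.numPairsAtDist 4 + 1 := by exact_mod_cast h2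
  have h3' : (2 * G.numPairsAtDist 3 : ℝ) + M.card ^ 2 ≤ Fintype.card V ^ 2 := by
    exact_mod_cast h3
  nlinarith

/-- The largest ratio `d_3 / d_4 = 2 * n - 8` occurs for a star with two edges subdivided; there
`d_2` is so large that the roots are still small. -/
lemma IsTree.norm_le_of_unique_pair_at_dist_four (hG : G.IsTree) (hn : 31 ≤ Fintype.card V)
    (hux : G.dist u x = 4)
    (hc : ∀ y, G.dist c y ≤ 2) (hc2 : ∀ y, G.dist c y = 2 → y = u ∨ y = x)
    (hsum : 2 * Fintype.card V ≤ (G.distSphere u 3).card + (G.distSphere x 3).card + 15)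
    {z : ℂ} (hz : G.IsWienerRoot z) : ‖z‖ ≤ 2 * Fintype.card V - 16 := by
  classical
  have hne : u ≠ x := by rintro rfl; simp at hux
  have hxu : G.dist x u = 4 := by rwa [dist_comm]
  have hdiam : G.diam = 4 := hG.connected.diam_eq_two_mul hc hux
  have tri : ∀ a b, G.dist a b ≤ G.dist c a + G.dist c b := fun a b ↦ by
    rw [dist_comm (u := c) (v := a)]; exact hG.connected.dist_triangle
  have h4 : G.numPairsAtDist 4 = 1 :=
    hG.connected.numPairsAtDist_two_mul_eq_one (k := 2) two_ne_zero hc hc2 hux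
  have h3 : (G.distSphere u 3).card + (G.distSphere x 3).card ≤ G.numPairsAtDist 3 :=
    card_distSphere_add_le_numPairsAtDist hne (by omega)
  have h3' : G.numPairsAtDist 3 ≤ (G.distSphere u 3).card + (G.distSphere x 3).card :=
    hG.connected.numPairsAtDist_le_of_add_one_eq (k := 2) hc hc2 rfl
  have hu := hG.connected.card_distSphere_add_card_distSphere_succ_le (i := 3) hux
  have hx := hG.connected.card_distSphere_add_card_distSphere_succ_le (i := 3) hxu
  have hu1 : 0 < (G.distSphere u (3 + 1)).card := Finset.card_pos.2 ⟨x, mem_distSphere.2 hux⟩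
  have hx1 : 0 < (G.distSphere x (3 + 1)).card := Finset.card_pos.2 ⟨u, mem_distSphere.2 hxu⟩
  have hS : Fintype.card V ≤ (G.distSphere c 1).card + 3 := by
    have : (Finset.univ : Finset V) ⊆ G.distSphere c 1 ∪ {c, u, x} := by
      intro y _
      have hy := hc y
      have hy2 := hc2 y
      simp only [Finset.mem_union, mem_distSphere, Finset.mem_insert, Finset.mem_singleton]
      by_cases h0 : G.dist c y = 0
      · exact .inr (.inl (hG.connected.dist_eq_zero_iff.1 h0).symm)
      · by_cases h1 : G.dist c y = 1
        · exact .inl h1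
        · exact .inr (.inr (hy2 (by omega)))
    calc _ ≤ _ := Finset.card_le_card this
      _ ≤ _ := Finset.card_union_le _ _
      _ ≤ _ := by gcongr; exact Finset.card_le_three
  have h2 : (G.distSphere c 1).offDiag.card ≤ (G.distPairs 2).card := by
    refine Finset.card_le_card fun p hp ↦ ?_
    rw [Finset.mem_offDiag, mem_distSphere, mem_distSphere] at hp
    rw [mem_distPairs]
    have h1 := tri p.1 p.2
    have h2 := hG.dist_add_mod_two c p.1 p.2
    have h3 := hG.connected.pos_dist_of_ne hp.2.2
    omega
  have h12 := G.sum_card_distPairs_le {1, 2}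
  rw [Finset.sum_pair (by norm_num)] at h12
  rw [Finset.offDiag_card] at h2
  rw [← two_mul_numPairsAtDist G (by norm_num)] at h2 h12
  rw [← two_mul_numPairsAtDist G (by norm_num)] at h12
  rw [isWienerRoot_iff, hdiam] at hz
  have hn' : (31 : ℝ) ≤ Fintype.card V := by exact_mod_cast hn
  have h2' : ((Fintype.card V : ℝ) - 3) * (Fintype.card V - 4) ≤ 2 * G.numPairsAtDist 2 := by
    have e : ((G.distSphere c 1).card : ℝ) * (G.distSphere c 1).card ≤
        2 * G.numPairsAtDist 2 + (G.distSphere c 1).card := by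
      exact_mod_cast Nat.sub_le_iff_le_add.1 h2
    have : (Fintype.card V : ℝ) ≤ (G.distSphere c 1).card + 3 := by exact_mod_cast hS
    nlinarith
  have h12' : (2 * G.numPairsAtDist 1 : ℝ) + 2 * G.numPairsAtDist 2 ≤ Fintype.card V ^ 2 := by
    exact_mod_cast h12
  have h3l : 2 * (Fintype.card V : ℝ) - 15 ≤ G.numPairsAtDist 3 := by
    rw [sub_le_iff_le_add]
    exact_mod_cast (show 2 * Fintype.card V ≤ G.numPairsAtDist 3 + 15 by omega)
  have h3u : (G.numPairsAtDist 3 : ℝ) ≤ 2 * (Fintype.card V : ℝ) - 8 := by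
    rw [le_sub_iff_add_le]
    exact_mod_cast (show G.numPairsAtDist 3 + 8 ≤ 2 * Fintype.card V by omega)
  by_contra! hlt
  have key := norm_mul_sq_sub_le_of_sum_eq_zero (m := 1)
    (c := fun i ↦ (G.numPairsAtDist (i + 1) : ℝ)) one_ne_zero (fun i ↦ by positivity)
    (by simp [h4]) (by norm_num; nlinarith) (by linarith) hz
  simp only [Finset.sum_range_one, zero_add] at key
  norm_num at key
  set r := ‖z‖
  set n : ℝ := (Fintype.card V : ℝ)
  have q1 : ((n - 3) * (n - 4) / 2 - 8 * (2 * n - 16)) ≤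
      r ^ 2 - G.numPairsAtDist 3 * r + G.numPairsAtDist 2 := by
    nlinarith
  have q2 : 0 < (n - 3) * (n - 4) / 2 - 8 * (2 * n - 16) := by nlinarith
  have q3 : (2 * n - 16) * ((n - 3) * (n - 4) / 2 - 8 * (2 * n - 16)) ≤
      r * (r ^ 2 - G.numPairsAtDist 3 * r + G.numPairsAtDist 2) :=
    mul_le_mul hlt.le q1 q2.le (by linarith)
  have q4 : (7 * n - 12) / 2 < (2 * n - 16) * ((n - 3) * (n - 4) / 2 - 8 * (2 * n - 16)) := by
    have : 10 ≤ (n - 3) * (n - 4) / 2 - 8 * (2 * n - 16) := by nlinarith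
    nlinarith
  linarith

lemma IsTree.of_extremal_pair_at_dist_four (hG : G.IsTree) (hn : 31 ≤ Fintype.card V)
    (hux : G.dist u x = 4)
    (hu : (G.distSphere u 4).card = 1) (hx : (G.distSphere x 4).card = 1)
    (hsum : 2 * Fintype.card V ≤ (G.distSphere u 3).card + (G.distSphere x 3).card + 15) :
    (G.numPairsAtDist 3 : ℝ) ≤ (2 * Fintype.card V - 16) * G.numPairsAtDist 4 ∨
      ∀ z, G.IsWienerRoot z → ‖z‖ ≤ 2 * Fintype.card V - 16 := by
  classical
  obtain ⟨c, hc1, hc2⟩ := hG.connected.exists_dist_eq_and_dist_eq_sub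
    (show 2 ≤ G.dist u x by omega)
  rw [hux] at hc2
  have hxu : G.dist x u = 4 := by rwa [dist_comm]
  have hcu : G.dist c u = 2 := by rwa [dist_comm]
  by_cases hfar : ∃ y, 3 ≤ G.dist c y
  · obtain ⟨y, hy⟩ := hfar
    left
    refine hG.numPairsAtDist_three_le hn (M := G.distSphere u 3 ∩ G.distSphere x 3) (c := c)
      (fun w hw ↦ ?_) ?_ hy
    · simp only [Finset.mem_inter, mem_distSphere] at hw
      have h1 := hG.dist_add_dist_le c w u x
      have h2 := hG.connected.dist_triangle (u := u) (v := c) (w := w)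
      rw [dist_comm (u := w) (v := u), dist_comm (u := w) (v := x)] at h1
      omega
    · have h1 : Disjoint (G.distSphere u 3 ∪ G.distSphere x 3) {u, x, c} := by
        rw [Finset.disjoint_right]
        intro w hw
        simp only [Finset.mem_insert, Finset.mem_singleton] at hw
        simp only [Finset.mem_union, mem_distSphere]
        have hxc : G.dist x c = 2 := by rwa [dist_comm]
        rcases hw with rfl | rfl | rfl <;> simp [*]
      have h2 := Finset.card_le_univ ((G.distSphere u 3 ∪ G.distSphere x 3) ∪ {u, x, c})
      have h3 : ({u, x, c} : Finset V).card = 3 := by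
        refine Finset.card_eq_three.2 ⟨u, x, c, ?_, ?_, ?_, rfl⟩ <;> rintro rfl <;> simp_all
      rw [Finset.card_union_of_disjoint h1, h3] at h2
      have h4 := Finset.card_union_add_card_inter (G.distSphere u 3) (G.distSphere x 3)
      omega
  · push Not at hfar
    right
    intro z hz
    refine hG.norm_le_of_unique_pair_at_dist_four hn hux (c := c) (fun y ↦ by have := hfar y; omega)
      (fun y hy ↦ ?_) hsum hz
    have h1 := hG.dist_add_dist_le u x c y
    have h2 := hG.connected.dist_triangle (u := u) (v := c) (w := y)
    have h3 := hG.connected.dist_triangle (u := x) (v := c) (w := y)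
    have hxc : G.dist x c = 2 := by rwa [dist_comm]
    rcases (show G.dist u y = 4 ∨ G.dist x y = 4 by omega) with h | h
    · exact .inr (Finset.card_le_one.1 hu.le _ (mem_distSphere.2 h) _ (mem_distSphere.2 hux))
    · exact .inl (Finset.card_le_one.1 hx.le _ (mem_distSphere.2 h) _ (mem_distSphere.2 hxu))

end Four

/-! ### The tree `treeT n` -/

/-- A function that grows by at most one along each edge is `1`-Lipschitz. -/
lemma Connected.le_add_dist (hG : G.Connected) {f : V → ℕ} (hf : ∀ a b, G.Adj a b → f b ≤ f a + 1)
    (u v : V) : f v ≤ f u + G.dist u v := by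
  obtain ⟨p, hp⟩ := hG.exists_walk_length_eq_dist u v
  rw [← hp]
  clear hp
  induction p with
  | nil => simp
  | cons h p ih =>
    have := hf _ _ h
    rw [Walk.length_cons]
    omega

lemma treeT_adj {n : ℕ} {a b : Fin n} : (treeT n).Adj a b ↔
    (b.val = a.val + 1 ∧ b.val ≤ 6) ∨ (a.val = 3 ∧ b.val = 7) ∨ (a.val = 7 ∧ 8 ≤ b.val) ∨
    (a.val = b.val + 1 ∧ a.val ≤ 6) ∨ (b.val = 3 ∧ a.val = 7) ∨ (b.val = 7 ∧ 8 ≤ a.val) := by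
  rw [treeT, fromRel_adj, ne_eq, Fin.ext_iff]
  omega

/-- The parent of a vertex of `treeT n` rooted at `0`. -/
def treeTParent {n : ℕ} (j : Fin n) : Fin n :=
  if h : j.val ≤ 6 then ⟨j.val - 1, by omega⟩
  else if h' : j.val = 7 then ⟨3, by omega⟩ else ⟨7, by omega⟩

lemma treeT_adj_parent {n : ℕ} {j : Fin n} (hj : j.val ≠ 0) :
    (treeT n).Adj j (treeTParent j) := by
  rw [treeT_adj, treeTParent]
  split_ifs <;> simp only [true_and, and_true] <;> omega

lemma connected_treeT {n : ℕ} (hn : n ≠ 0) : (treeT n).Connected := by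
  have h0 : ∀ k (hk : k < n), (treeT n).Reachable ⟨k, hk⟩ ⟨0, by omega⟩ := by
    intro k
    induction k using Nat.strong_induction_on with
    | _ k ih =>
      intro hk
      by_cases h : k = 0
      · subst h; rfl
      · refine (treeT_adj_parent (j := ⟨k, hk⟩) h).reachable.trans (ih (treeTParent ⟨k, hk⟩).val ?_ (Fin.is_lt _))
        rw [treeTParent]
        split_ifs <;> simp only <;> simp only at * <;> omega
  have : Nonempty (Fin n) := ⟨⟨0, by omega⟩⟩
  exact ⟨fun a b ↦ (h0 a a.2).trans (h0 b b.2).symm⟩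

lemma isTree_treeT {n : ℕ} (hn : n ≠ 0) : (treeT n).IsTree := by
  classical
  have hconn := connected_treeT hn
  -- every edge joins a vertex other than `0` to its parent, so there are at most `n - 1` edges
  refine isTree_iff_connected_and_card.2 ⟨hconn, le_antisymm ?_
    hconn.card_vert_le_card_edgeSet_add_one⟩
  have hsub : (treeT n).edgeSet ⊆
      (((Finset.univ.erase (⟨0, by omega⟩ : Fin n)).image fun j ↦ s(j, treeTParent j) :
        Finset (Sym2 (Fin n))) : Set (Sym2 (Fin n))) := by
    intro e
    induction e with
    | _ a b =>
      intro h
      rw [mem_edgeSet, treeT_adj] at h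
      have hpar : (b.val ≠ 0 ∧ a = treeTParent b) ∨ (a.val ≠ 0 ∧ b = treeTParent a) := by
        simp only [treeTParent, Fin.ext_iff]
        split_ifs <;> simp only <;> omega
      simp only [Finset.coe_image, Set.mem_image, Finset.mem_coe, Finset.mem_erase,
        Finset.mem_univ, and_true, ne_eq, Fin.ext_iff]
      rcases hpar with ⟨h1, h2⟩ | ⟨h1, h2⟩
      · exact ⟨b, h1, by rw [← h2, Sym2.eq_swap]⟩
      · exact ⟨a, h1, by rw [← h2]⟩
  have h1 := Set.ncard_le_ncard hsub (Finset.finite_toSet _)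
  rw [Set.ncard_coe_finset] at h1
  have h2 := h1.trans Finset.card_image_le
  rw [Finset.card_erase_of_mem (Finset.mem_univ _), Finset.card_univ, Fintype.card_fin] at h2
  rw [Nat.card_fin]
  change (treeT n).edgeSet.ncard + 1 ≤ n
  omega

/-- A tree containing a copy of `treeT 8` all of whose other vertices are adjacent to the vertex
`7` of the copy. -/
lemma IsTree.nonempty_iso_treeT [Fintype V] (hG : G.IsTree) {p : Fin 8 → V}
    (hp : Function.Injective p) (hadj : ∀ i j, (treeT 8).Adj i j → G.Adj (p i) (p j))
    (hleaf : ∀ y ∉ Set.range p, G.Adj (p 7) y) : Nonempty (G ≃g treeT (Fintype.card V)) := by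
  classical
  set n := Fintype.card V with hn
  have hn8 : 8 ≤ n := by
    have := Fintype.card_le_of_injective p hp
    rwa [Fintype.card_fin] at this
  set f : Fin n → V := fun i ↦ if h : i.val < 8 then p ⟨i, h⟩ else p 7 with hf
  obtain ⟨g, hg⟩ := Finset.exists_equiv_extend_of_card_eq (α := Fin n)
    (t := (Finset.univ : Finset V)) (s := Finset.univ.filter fun i ↦ i.val < 8) (f := f) (by simp [hn]) (Finset.subset_univ _) (by
      intro i hi j hj hij
      have hi' : i.val < 8 := by simpa using hi
      have hj' : j.val < 8 := by simpa using hj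
      simp only [hf, hi', hj', dif_pos] at hij
      have := hp hij
      rw [Fin.mk.injEq] at this
      exact Fin.ext this)
  have hg' : ∀ i (hi : i.val < 8), (g i : V) = p ⟨i, hi⟩ := by
    intro i hi
    rw [hg i (by simpa using hi)]
    simp [hf, hi]
  have hg8 : ∀ i : Fin n, 8 ≤ i.val → G.Adj (p 7) (g i) := by
    intro i hi
    refine hleaf _ ?_
    rintro ⟨j, hj⟩
    have h1 : (g ⟨j, by omega⟩ : V) = p j := hg' ⟨j, by omega⟩ j.2
    have h2 : (⟨j, by omega⟩ : Fin n) = i := g.injective (Subtype.ext (h1.trans hj))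
    have := congrArg Fin.val h2
    simp only at this
    omega
  let e : Fin n ≃ V := g.trans (Equiv.subtypeUnivEquiv Finset.mem_univ)
  have he : ∀ i, e i = (g i : V) := fun i ↦ rfl
  let I : G.comap e ≃g G := ⟨e, Iff.rfl⟩
  have hle : treeT n ≤ G.comap e := by
    have key : ∀ i j : Fin n, i.val < j.val → (treeT n).Adj i j → G.Adj (e i) (e j) := by
      intro i j hlt hij
      rw [he, he]
      by_cases hj : j.val < 8
      · have hi : i.val < 8 := by omega
        rw [hg' i hi, hg' j hj]
        refine hadj _ _ ?_
        rw [treeT_adj] at hij ⊢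
        exact hij
      · rw [treeT_adj] at hij
        have hi : i.val = 7 := by omega
        rw [hg' i (by omega), show (⟨i, by omega⟩ : Fin 8) = 7 from Fin.ext hi]
        exact hg8 j (by omega)
    intro i j hij
    rcases lt_trichotomy i.val j.val with h | h | h
    · exact key i j h hij
    · exact absurd (Fin.ext h) hij.ne
    · exact (key j i h hij.symm).symm
  have htree : (G.comap e).IsTree := I.isTree_iff.2 hG
  have heq : treeT n = G.comap e := le_antisymm hle
    ((isTree_iff_minimal_connected.1 htree).2 (connected_treeT (by omega)) hle)
  rw [heq]
  exact ⟨I.symm⟩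

/-! ### Trees with an extremal pair at distance six -/

section Six

variable [Fintype V]

lemma card_mul_card_le_numPairsAtDist {M Q : Finset V} (hi : i ≠ 0) (hMQ : Disjoint M Q)
    (h : ∀ a ∈ M, ∀ b ∈ Q, G.dist a b = i) : M.card * Q.card ≤ G.numPairsAtDist i := by
  classical
  have hdisj : Disjoint (M ×ˢ Q) (Q ×ˢ M) := by
    rw [Finset.disjoint_left]
    intro p hp hp'
    rw [Finset.mem_product] at hp hp'
    exact Finset.disjoint_left.1 hMQ hp.1 hp'.1
  have hsub : (M ×ˢ Q) ∪ (Q ×ˢ M) ⊆ G.distPairs i := by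
    intro p hp
    rw [Finset.mem_union, Finset.mem_product, Finset.mem_product] at hp
    rw [mem_distPairs]
    rcases hp with hp | hp
    · exact h _ hp.1 _ hp.2
    · rw [dist_comm]; exact h _ hp.2 _ hp.1
  have h1 := Finset.card_le_card hsub
  rw [Finset.card_union_of_disjoint hdisj, Finset.card_product, Finset.card_product,
    ← two_mul_numPairsAtDist G hi, mul_comm Q.card] at h1
  omega

/-- The root bound for the tree that differs from `treeT n` in that one leaf hangs at a neighbour
of the centre on the path. Its `d_5` is only one less than for `treeT n`, but a large `d_4` makes up
for it. -/
lemma IsTree.norm_le_of_unique_pair_at_dist_six (hG : G.IsTree) (hn : 31 ≤ Fintype.card V)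
    (hux : G.dist u x = 6)
    (hc : ∀ y, G.dist c y ≤ 3) (hc3 : ∀ y, G.dist c y = 3 → y = u ∨ y = x)
    (hsum : (G.distSphere u 5).card + (G.distSphere x 5).card + 15 = 2 * Fintype.card V)
    (h4 : 3 * Fintype.card V ≤ G.numPairsAtDist 4 + 27)
    {z : ℂ} (hz : G.IsWienerRoot z) : ‖z‖ ≤ 2 * Fintype.card V - 16 := by
  have hne : u ≠ x := by rintro rfl; simp at hux
  have hdiam : G.diam = 6 := hG.connected.diam_eq_two_mul hc hux
  have h6 : G.numPairsAtDist 6 = 1 :=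
    hG.connected.numPairsAtDist_two_mul_eq_one (k := 3) three_ne_zero hc hc3 hux
  have h5l : (G.distSphere u 5).card + (G.distSphere x 5).card ≤ G.numPairsAtDist 5 :=
    card_distSphere_add_le_numPairsAtDist hne (by omega)
  have h5u : G.numPairsAtDist 5 ≤ (G.distSphere u 5).card + (G.distSphere x 5).card :=
    hG.connected.numPairsAtDist_le_of_add_one_eq (k := 3) hc hc3 rfl
  have htot := G.sum_card_distPairs_le {1, 2, 3, 4}
  rw [Finset.sum_insert (by decide), Finset.sum_insert (by decide), Finset.sum_pair (by decide),
    ← two_mul_numPairsAtDist G one_ne_zero, ← two_mul_numPairsAtDist G two_ne_zero,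
    ← two_mul_numPairsAtDist G three_ne_zero, ← two_mul_numPairsAtDist G four_ne_zero] at htot
  rw [isWienerRoot_iff, hdiam] at hz
  have hn' : (31 : ℝ) ≤ Fintype.card V := by exact_mod_cast hn
  have htot' : (2 * G.numPairsAtDist 1 : ℝ) + (2 * G.numPairsAtDist 2 + (2 * G.numPairsAtDist 3 +
      2 * G.numPairsAtDist 4)) ≤ Fintype.card V ^ 2 := by
    exact_mod_cast htot
  have h5 : (G.numPairsAtDist 5 : ℝ) = 2 * Fintype.card V - 15 := by
    rw [eq_sub_iff_add_eq]
    exact_mod_cast (show G.numPairsAtDist 5 + 15 = 2 * Fintype.card V by omega)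
  have h4' : (3 * Fintype.card V : ℝ) ≤ G.numPairsAtDist 4 + 27 := by exact_mod_cast h4
  by_contra! hlt
  have key := norm_mul_sq_sub_le_of_sum_eq_zero (m := 3)
    (c := fun i ↦ (G.numPairsAtDist (i + 1) : ℝ)) three_ne_zero (fun i ↦ by positivity)
    (by simp [h6]) (by norm_num [h5]; nlinarith) (by linarith) hz
  simp only [Finset.sum_range_succ, Finset.sum_range_zero, zero_add] at key
  norm_num [h5] at key
  set r := ‖z‖
  set n : ℝ := (Fintype.card V : ℝ)
  have q1 : n - 11 ≤ r ^ 2 - (2 * n - 15) * r + G.numPairsAtDist 4 := by nlinarith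
  have q3 : (2 * n - 16) * (n - 11) ≤
      r * (r ^ 2 - (2 * n - 15) * r + G.numPairsAtDist 4) :=
    mul_le_mul hlt.le q1 (by linarith) (by linarith)
  nlinarith

/-- The case of a single vertex `y` outside the eight vertices of the core and the common part `M`
of the two spheres. -/
lemma IsTree.norm_le_of_exceptional_vertex (hG : G.IsTree) (hn : 31 ≤ Fintype.card V)
    {p q : V} {M : Finset V} (hux : G.dist u x = 6) (hcu : G.dist c u = 3) (hcx : G.dist c x = 3)
    (hup : G.dist u p = 1) (hxp : G.dist x p = 5) (hcp : G.dist c p = 2)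
    (huq : G.dist u q = 5) (hxq : G.dist x q = 1) (hcq : G.dist c q = 2)
    (hMu : ∀ w ∈ M, G.dist u w = 5) (hMx : ∀ w ∈ M, G.dist x w = 5)
    (hMc : ∀ w ∈ M, G.dist c w = 2) (hcard : M.card + 9 = Fintype.card V)
    (hsum : (G.distSphere u 5).card + (G.distSphere x 5).card + 15 = 2 * Fintype.card V)
    (hyu : G.dist u y = 5) (hyx : G.dist x y ≠ 5) (hyq : y ≠ q)
    (hrest : ∀ z, z ≠ y → z ≠ u → z ≠ x → G.dist c z ≤ 2)
    {z : ℂ} (hz : G.IsWienerRoot z) : ‖z‖ ≤ 2 * Fintype.card V - 16 := by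
  classical
  have hxu : G.dist x u = 6 := by rwa [dist_comm]
  have hpar := hG.dist_add_mod_two x u y
  have hyc : G.dist c y ≤ 2 := by
    have h4 := hG.dist_add_dist_le c y u x
    rw [dist_comm (u := y) (v := x), dist_comm (u := y) (v := u)] at h4
    by_contra! hgt
    -- otherwise the parent of `y` has distance at least `3` from `c`, hence is `u` or `x`
    have hne : y ≠ c := by rintro rfl; simp at hgt
    obtain ⟨t, hyt, ht⟩ := hG.connected.exists_adj_dist_add_one_eq hne
    have hty : t ≠ y := hyt.ne'
    rw [dist_comm (u := t), dist_comm (u := y)] at ht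
    have hpar' := hG.dist_add_mod_two c u y
    have hyt' : G.dist y t = 1 := dist_eq_one_iff_adj.2 hyt
    rw [dist_comm] at hyt'
    by_cases htu : t = u
    · subst htu; omega
    · by_cases htx : t = x
      · subst htx; omega
      · have := hrest t hty htu htx
        omega
  have hxy : G.dist x y = 3 := by
    have h1 := hG.connected.dist_triangle (u := x) (v := c) (w := y)
    rw [dist_comm (u := x) (v := c)] at h1
    have h2 : G.dist x y ≠ 1 := by
      intro h
      have h4 := hG.dist_add_dist_le y q u x
      rw [dist_comm (u := y) (v := u), dist_comm (u := y) (v := x), dist_comm (u := q) (v := u),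
        dist_comm (u := q) (v := x)] at h4
      exact hyq (hG.connected.dist_eq_zero_iff.1 (by omega))
    omega
  have hMQ : ∀ w ∈ M, ∀ t ∈ ({p, q, y} : Finset V), G.dist w t = 4 := by
    intro w hw t ht
    have h1 := hMu w hw
    have h2 := hMx w hw
    have h3 := hMc w hw
    have h4 := hG.connected.dist_triangle (u := w) (v := c) (w := t)
    have h5 := hG.connected.dist_triangle (u := u) (v := t) (w := w)
    have h6 := hG.connected.dist_triangle (u := x) (v := t) (w := w)
    have h7 := hG.dist_add_dist_le x w u y
    rw [dist_comm (u := w) (v := c)] at h4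
    rw [dist_comm (u := t) (v := w)] at h5 h6
    rw [dist_comm (u := w) (v := u)] at h7
    simp only [Finset.mem_insert, Finset.mem_singleton] at ht
    rcases ht with rfl | rfl | rfl <;> omega
  have hQ : ({p, q, y} : Finset V).card = 3 := by
    refine Finset.card_eq_three.2 ⟨p, q, y, ?_, ?_, hyq.symm, rfl⟩ <;> rintro rfl <;> omega
  have hdisj : Disjoint M {p, q, y} := by
    rw [Finset.disjoint_left]
    intro w hw hw'
    have := hMQ w hw w hw'
    simp at this
  have h4 := card_mul_card_le_numPairsAtDist four_ne_zero hdisj hMQ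
  rw [hQ] at h4
  refine hG.norm_le_of_unique_pair_at_dist_six hn hux (c := c) (fun t ↦ ?_) (fun t ht ↦ ?_) hsum
    (by omega) hz
  · by_cases h1 : t = y
    · subst h1; omega
    by_cases h2 : t = u
    · subst h2; omega
    by_cases h3 : t = x
    · subst h3; omega
    exact (hrest t h1 h2 h3).trans (by norm_num)
  · by_contra! h
    have h1 : t ≠ y := by rintro rfl; omega
    have := hrest t h1 h.1 h.2
    omega

lemma IsTree.of_extremal_pair_at_dist_six (hG : G.IsTree) (hn : 31 ≤ Fintype.card V)
    (hux : G.dist u x = 6)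
    (hsum : 2 * Fintype.card V ≤ (G.distSphere u 5).card + (G.distSphere x 5).card + 15) :
    Nonempty (G ≃g treeT (Fintype.card V)) ∨
      ∀ z, G.IsWienerRoot z → ‖z‖ ≤ 2 * Fintype.card V - 16 := by
  classical
  have hconn := hG.connected
  -- the path from `u` to `x`
  have step : ∀ t, G.dist t x ≠ 0 → ∃ s, G.Adj t s ∧ G.dist s x + 1 = G.dist t x := fun t ht ↦
    hconn.exists_adj_dist_add_one_eq (by rintro rfl; simp at ht)
  obtain ⟨q1, a1, e1⟩ := step u (by omega)
  obtain ⟨q2, a2, e2⟩ := step q1 (by omega)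
  obtain ⟨c, a3, e3⟩ := step q2 (by omega)
  obtain ⟨q4, a4, e4⟩ := step c (by omega)
  obtain ⟨q5, a5, e5⟩ := step q4 (by omega)
  have a6 : G.Adj q5 x := dist_eq_one_iff_adj.1 (by omega)
  have adv : ∀ t s, G.Adj t s → G.dist u s ≤ G.dist u t + 1 := fun t s h ↦ by
    rw [← dist_eq_one_iff_adj.2 h]; exact hconn.dist_triangle
  have far : ∀ t, 6 ≤ G.dist u t + G.dist t x := fun t ↦ hux ▸ hconn.dist_triangle
  have b0 : G.dist u u = 0 := dist_self
  have b1 := adv _ _ a1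
  have b2 := adv _ _ a2
  have b3 := adv _ _ a3
  have b4 := adv _ _ a4
  have b5 := adv _ _ a5
  have f1 := far q1
  have f2 := far q2
  have f3 := far c
  have f4 := far q4
  have f5 := far q5
  have hcu : G.dist c u = 3 := by rw [dist_comm]; omega
  have hcx : G.dist c x = 3 := by omega
  set M := G.distSphere u 5 ∩ G.distSphere x 5 with hM
  set U := G.distSphere u 5 ∪ G.distSphere x 5 with hU
  have hUM : U.card + M.card = (G.distSphere u 5).card + (G.distSphere x 5).card :=
    Finset.card_union_add_card_inter _ _
  have hMu : ∀ w ∈ M, G.dist u w = 5 := fun w hw ↦ mem_distSphere.1 (Finset.mem_inter.1 hw).1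
  have hMx : ∀ w ∈ M, G.dist x w = 5 := fun w hw ↦ mem_distSphere.1 (Finset.mem_inter.1 hw).2
  have hMc : ∀ w ∈ M, G.dist c w = 2 := by
    intro w hw
    have h1 := hMu w hw
    have h2 := hMx w hw
    have h3 := hG.dist_add_dist_le c w u x
    have h4 := hconn.dist_triangle (u := u) (v := c) (w := w)
    rw [dist_comm (u := w) (v := u), dist_comm (u := w) (v := x)] at h3
    rw [dist_comm (u := u) (v := c)] at h4
    omega
  -- the parents of the vertices of `M`
  have hpar : ∀ w ∈ M, ∃ t, G.Adj c t ∧ G.Adj t w ∧ G.dist u t = 4 ∧ G.dist x t = 4 := by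
    intro w hw
    have h0 := hMc w hw
    obtain ⟨t, h1, h2⟩ := hconn.exists_adj_dist_add_one_eq
      (show c ≠ w by rintro rfl; simp at h0)
    have h3 : G.Adj t w := dist_eq_one_iff_adj.1 (by omega)
    have h4 : ∀ s, G.dist c s = 3 → G.dist s w = 5 → G.dist s t = 4 := by
      intro s hs hsw
      have h5 := hconn.dist_triangle (u := s) (v := c) (w := t)
      have h6 := hconn.dist_triangle (u := s) (v := t) (w := w)
      rw [dist_comm (u := s) (v := c), dist_eq_one_iff_adj.2 h1] at h5
      rw [dist_eq_one_iff_adj.2 h3] at h6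
      omega
    exact ⟨t, h1, h3, h4 u hcu (hMu w hw), h4 x hcx (hMx w hw)⟩
  have hMpos : M.Nonempty := by
    rw [← Finset.card_pos]
    have := Finset.card_le_univ U
    omega
  obtain ⟨w₀, hw₀⟩ := hMpos
  obtain ⟨v, hcv, hvw, huv, hxv⟩ := hpar w₀ hw₀
  set p : Fin 8 → V := ![u, q1, q2, c, q4, q5, x, v] with hp
  have hA : ∀ j, G.dist u (p j) = (![0, 1, 2, 3, 4, 5, 6, 4] : Fin 8 → ℕ) j := by
    intro j
    fin_cases j <;> simp [hp] <;> omega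
  have hB : ∀ j, G.dist x (p j) = (![6, 5, 4, 3, 2, 1, 0, 4] : Fin 8 → ℕ) j := by
    intro j
    rw [dist_comm]
    rw [dist_comm] at hxv
    fin_cases j <;> simp [hp] <;> omega
  have hpinj : Function.Injective p := by
    intro j k hjk
    have h1 := hA j
    have h2 := hB j
    rw [hjk, hA] at h1
    rw [hjk, hB] at h2
    clear hjk
    revert j k
    decide
  have hUp : ∀ s : Finset (Fin 8), (∀ j ∈ s, (![0, 1, 2, 3, 4, 5, 6, 4] : Fin 8 → ℕ) j ≠ 5 ∧
      (![6, 5, 4, 3, 2, 1, 0, 4] : Fin 8 → ℕ) j ≠ 5) → Disjoint U (s.image p) := by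
    intro s hs
    rw [Finset.disjoint_right]
    intro t ht
    obtain ⟨j, hj, rfl⟩ := Finset.mem_image.1 ht
    rw [Finset.mem_union, mem_distSphere, mem_distSphere, hA, hB]
    have := hs j hj
    tauto
  have hMp : Disjoint M (Finset.univ.image p) := by
    rw [Finset.disjoint_right]
    intro t ht
    obtain ⟨j, hj, rfl⟩ := Finset.mem_image.1 ht
    rw [Finset.mem_inter, mem_distSphere, mem_distSphere, hA, hB]
    clear ht hj
    revert j
    decide
  have hUp' : Disjoint U (({0, 2, 3, 4, 6, 7} : Finset (Fin 8)).image p) := hUp _ (by decide)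
  have hcardp : ∀ s : Finset (Fin 8), (s.image p).card = s.card := fun s ↦
    Finset.card_image_of_injective _ hpinj
  have hUcard : U.card + 6 ≤ Fintype.card V := by
    have := Finset.card_le_univ (U ∪ ({0, 2, 3, 4, 6, 7} : Finset (Fin 8)).image p)
    rwa [Finset.card_union_of_disjoint hUp', hcardp] at this
  have hMcard : M.card + 8 ≤ Fintype.card V := by
    have := Finset.card_le_univ (M ∪ (Finset.univ : Finset (Fin 8)).image p)
    rwa [Finset.card_union_of_disjoint hMp, hcardp] at this
  -- a second parent would be one more vertex outside both spheres
  have hMv : ∀ w ∈ M, G.Adj v w := by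
    intro w hw
    obtain ⟨v', hcv', hvw', huv', hxv'⟩ := hpar w hw
    by_contra hvw
    have hvv' : v ≠ v' := by rintro rfl; exact hvw hvw'
    have hv'p : ∀ j, p j ≠ v' := by
      rintro j rfl
      rw [hA] at huv'
      rw [hB] at hxv'
      have key : ∀ j : Fin 8, (![0, 1, 2, 3, 4, 5, 6, 4] : Fin 8 → ℕ) j = 4 →
          (![6, 5, 4, 3, 2, 1, 0, 4] : Fin 8 → ℕ) j = 4 → j = 7 := by decide
      obtain rfl := key j huv' hxv'
      exact hvv' rfl
    have hv'im : ∀ s : Finset (Fin 8), v' ∉ s.image p := by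
      intro s h
      obtain ⟨j, -, hj⟩ := Finset.mem_image.1 h
      exact hv'p j hj
    have h1 : U.card + 7 ≤ Fintype.card V := by
      have hd : Disjoint U (insert v' (({0, 2, 3, 4, 6, 7} : Finset (Fin 8)).image p)) := by
        rw [Finset.disjoint_insert_right]
        exact ⟨by simp [hU, huv', hxv'], hUp'⟩
      have := Finset.card_le_univ (U ∪ insert v' (({0, 2, 3, 4, 6, 7} : Finset (Fin 8)).image p))
      rwa [Finset.card_union_of_disjoint hd, Finset.card_insert_of_notMem (hv'im _),
        hcardp] at this
    have h2 : M.card + 9 ≤ Fintype.card V := by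
      have hd : Disjoint M (insert v' ((Finset.univ : Finset (Fin 8)).image p)) := by
        rw [Finset.disjoint_insert_right]
        exact ⟨by simp [hM, huv'], hMp⟩
      have := Finset.card_le_univ (M ∪ insert v' ((Finset.univ : Finset (Fin 8)).image p))
      rwa [Finset.card_union_of_disjoint hd, Finset.card_insert_of_notMem (hv'im _),
        hcardp] at this
    omega
  rcases (show M.card + 8 = Fintype.card V ∨ M.card + 9 = Fintype.card V by omega) with h8 | h9
  · left
    have huniv : M ∪ (Finset.univ : Finset (Fin 8)).image p = Finset.univ := by
      rw [← Finset.card_eq_iff_eq_univ, Finset.card_union_of_disjoint hMp, hcardp]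
      exact h8
    refine hG.nonempty_iso_treeT hpinj ?_ fun y hy ↦ hMv y ?_
    · intro i j hij
      rw [treeT_adj] at hij
      have s1 := a1.symm
      have s2 := a2.symm
      have s3 := a3.symm
      have s4 := a4.symm
      have s5 := a5.symm
      have s6 := a6.symm
      have s7 := hcv.symm
      fin_cases i <;> fin_cases j <;> first | (simp at hij; done) | (simp only [hp]; assumption)
    · have := Finset.mem_univ y
      rw [← huniv, Finset.mem_union] at this
      refine this.resolve_right fun h ↦ hy ?_
      obtain ⟨j, -, hj⟩ := Finset.mem_image.1 h
      exact ⟨j, hj⟩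
  · right
    obtain ⟨y, hy⟩ : ∃ y, (M ∪ (Finset.univ : Finset (Fin 8)).image p)ᶜ = {y} := by
      rw [← Finset.card_eq_one, Finset.card_compl, Finset.card_union_of_disjoint hMp, hcardp,
        Finset.card_univ, Fintype.card_fin]
      omega
    have hyK : y ∉ M ∪ (Finset.univ : Finset (Fin 8)).image p := by
      rw [← Finset.mem_compl, hy]
      exact Finset.mem_singleton_self y
    have hrest : ∀ z, z ≠ y → z ∈ M ∨ ∃ j, p j = z := by
      intro z hz
      have : z ∉ (M ∪ (Finset.univ : Finset (Fin 8)).image p)ᶜ := by simpa [hy] using hz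
      rw [Finset.mem_compl, not_not, Finset.mem_union] at this
      exact this.imp id fun h ↦ by simpa using h
    rw [Finset.mem_union, not_or] at hyK
    have hyp : ∀ j, p j ≠ y := fun j hj ↦ hyK.2 (Finset.mem_image.2 ⟨j, Finset.mem_univ _, hj⟩)
    -- the spheres are too large to miss `y` as well
    have hyU : y ∈ U := by
      by_contra hyU
      have hd : Disjoint U (insert y (({0, 2, 3, 4, 6, 7} : Finset (Fin 8)).image p)) := by
        rw [Finset.disjoint_insert_right]
        exact ⟨hyU, hUp'⟩
      have := Finset.card_le_univ (U ∪ insert y (({0, 2, 3, 4, 6, 7} : Finset (Fin 8)).image p))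
      rw [Finset.card_union_of_disjoint hd, Finset.card_insert_of_notMem (by
        intro h
        obtain ⟨j, -, hj⟩ := Finset.mem_image.1 h
        exact hyp j hj), hcardp] at this
      have h6 : ({0, 2, 3, 4, 6, 7} : Finset (Fin 8)).card = 6 := rfl
      omega
    have hdc : ∀ t s, G.Adj t s → G.dist c s ≤ G.dist c t + 1 := fun t s h ↦ by
      rw [← dist_eq_one_iff_adj.2 h]; exact hconn.dist_triangle
    have c0 : G.dist c c = 0 := dist_self
    have c2 := hdc _ _ a3.symm
    have c1 := hdc _ _ a2.symm
    have c0' := hdc _ _ a1.symm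
    have c4 := hdc _ _ a4
    have c5 := hdc _ _ a5
    have c6 := hdc _ _ a6
    have c7 := hdc _ _ hcv
    have hrest' : ∀ z, z ≠ y → z ≠ u → z ≠ x → G.dist c z ≤ 2 := by
      intro z hzy hzu hzx
      rcases hrest z hzy with h | ⟨j, rfl⟩
      · exact (hMc z h).le
      · fin_cases j
        · exact absurd rfl hzu
        · change G.dist c q1 ≤ 2; omega
        · change G.dist c q2 ≤ 2; omega
        · change G.dist c c ≤ 2; omega
        · change G.dist c q4 ≤ 2; omega
        · change G.dist c q5 ≤ 2; omega
        · exact absurd rfl hzx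
        · change G.dist c v ≤ 2; omega
    have hA1 : G.dist u q1 = 1 := hA 1
    have hA5 : G.dist u q5 = 5 := hA 5
    have hB1 : G.dist x q1 = 5 := hB 1
    have hB5 : G.dist x q5 = 1 := hB 5
    have hy1 : y ≠ q1 := fun h ↦ hyp 1 h.symm
    have hy5 : y ≠ q5 := fun h ↦ hyp 5 h.symm
    intro z hz
    rw [Finset.mem_union, mem_distSphere, mem_distSphere] at hyU
    rw [Finset.mem_inter, mem_distSphere, mem_distSphere] at hyK
    rcases hyU with hyu | hyx
    · exact hG.norm_le_of_exceptional_vertex hn hux hcu hcx hA1 hB1 (by omega) hA5 hB5 (by omega)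
        hMu hMx hMc h9 (by omega) hyu (fun h ↦ hyK.1 ⟨hyu, h⟩) hy5 hrest' hz
    · exact hG.norm_le_of_exceptional_vertex hn (by rwa [dist_comm]) hcx hcu hB5 hA5 (by omega)
        hB1 hA1 (by omega) hMx hMu hMc h9 (by omega) hyx (fun h ↦ hyK.1 ⟨h, hyx⟩) hy1
        (fun z h1 h2 h3 ↦ hrest' z h1 h3 h2) hz

end Six

/-! ### The large Wiener root of `treeT n` -/

/-- The tree `treeT n` has a real Wiener root to the left of `-(2 * n - 16)`. -/
lemma exists_isWienerRoot_treeT {n : ℕ} (hn : 31 ≤ n) :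
    ∃ z, (treeT n).IsWienerRoot z ∧ 2 * (n : ℝ) - 16 < ‖z‖ := by
  classical
  set G := treeT n with hG
  have hconn : G.Connected := connected_treeT (by omega)
  -- distances from `0`, `6` and `3` are bounded below by explicit `1`-Lipschitz functions
  have lip : ∀ f : ℕ → ℕ, (∀ a b, (treeT n).Adj a b → f b.val ≤ f a.val + 1) →
      ∀ a b, f b.val ≤ f a.val + G.dist a b := fun f hf a b ↦
    hconn.le_add_dist (f := fun i ↦ f i.val) hf a b
  have hl0 := lip (fun i ↦ if i ≤ 6 then i else if i = 7 then 4 else 5) (by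
    intro a b h
    rw [treeT_adj] at h
    split_ifs <;> omega)
  have hl6 := lip (fun i ↦ if i ≤ 6 then 6 - i else if i = 7 then 4 else 5) (by
    intro a b h
    rw [treeT_adj] at h
    split_ifs <;> omega)
  have adj : ∀ a b c : Fin n, G.Adj a b → G.dist c b ≤ G.dist c a + 1 := fun a b c h ↦ by
    rw [← dist_eq_one_iff_adj.2 h]; exact hconn.dist_triangle
  have tri : ∀ a b c : Fin n, G.dist a b ≤ G.dist c a + G.dist c b := fun a b c ↦ by
    rw [dist_comm (u := c) (v := a)]; exact hconn.dist_triangle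
  obtain ⟨q, hq⟩ : ∃ q : Fin 8 → Fin n, ∀ j, (q j).val = j.val :=
    ⟨Fin.castLE (by omega), fun j ↦ rfl⟩
  have hq' : ∀ (a : Fin n) (j : Fin 8), a.val = j.val → a = q j := fun a j h ↦
    Fin.ext (h.trans (hq j).symm)
  have hqadj : ∀ i j : Fin 8, (treeT 8).Adj i j → G.Adj (q i) (q j) := by
    intro i j h
    rw [treeT_adj] at h
    rw [hG, treeT_adj, hq, hq]
    exact h
  have d0 : G.dist (q 3) (q 3) = 0 := dist_self
  have d2 := adj _ _ (q 3) (hqadj 3 2 (by rw [treeT_adj]; decide))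
  have d1 := adj _ _ (q 3) (hqadj 2 1 (by rw [treeT_adj]; decide))
  have d0' := adj _ _ (q 3) (hqadj 1 0 (by rw [treeT_adj]; decide))
  have d4 := adj _ _ (q 3) (hqadj 3 4 (by rw [treeT_adj]; decide))
  have d5 := adj _ _ (q 3) (hqadj 4 5 (by rw [treeT_adj]; decide))
  have d6 := adj _ _ (q 3) (hqadj 5 6 (by rw [treeT_adj]; decide))
  have d7 := adj _ _ (q 3) (hqadj 3 7 (by rw [treeT_adj]; decide))
  have hleaf : ∀ a : Fin n, 8 ≤ a.val → G.Adj (q 7) a := by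
    intro a ha
    rw [hG, treeT_adj, hq]
    right; right; left
    exact ⟨rfl, ha⟩
  have hdist : ∀ a : Fin n, a.val ≠ 0 → a.val ≠ 6 → G.dist (q 3) a ≤ 2 := by
    intro a h0 h6
    by_cases ha : 8 ≤ a.val
    · have := adj _ _ (q 3) (hleaf a ha)
      omega
    · obtain h | h | h | h | h | h : a.val = 1 ∨ a.val = 2 ∨ a.val = 3 ∨ a.val = 4 ∨ a.val = 5 ∨
        a.val = 7 := by omega
      · rw [hq' a 1 h]; omega
      · rw [hq' a 2 h]; omega
      · rw [hq' a 3 h]; omega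
      · rw [hq' a 4 h]; omega
      · rw [hq' a 5 h]; omega
      · rw [hq' a 7 h]; omega
  have hc : ∀ a, G.dist (q 3) a ≤ 3 := by
    intro a
    by_cases h0 : a.val = 0
    · rw [hq' a 0 h0]; omega
    by_cases h6 : a.val = 6
    · rw [hq' a 6 h6]; omega
    exact (hdist a h0 h6).trans (by norm_num)
  have hc3 : ∀ a, G.dist (q 3) a = 3 → a = q 0 ∨ a = q 6 := by
    intro a ha
    by_cases h0 : a.val = 0
    · exact .inl (hq' a 0 h0)
    by_cases h6 : a.val = 6
    · exact .inr (hq' a 6 h6)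
    have := hdist a h0 h6
    omega
  have h06 : G.dist (q 0) (q 6) = 6 := by
    have h1 := hl0 (q 0) (q 6)
    have h2 := tri (q 0) (q 6) (q 3)
    simp only [hq] at h1
    norm_num at h1
    omega
  have hdiam : G.diam = 6 := hconn.diam_eq_two_mul hc h06
  have h6 : G.numPairsAtDist 6 = 1 :=
    hconn.numPairsAtDist_two_mul_eq_one (k := 3) three_ne_zero hc hc3 h06
  have hlow : ∀ l : List (Fin 8), l.length = 7 → ∀ a : Fin n,
      (∀ w, w ∉ (l.map q).toFinset → G.dist a w = 5) → n ≤ (G.distSphere a 5).card + 7 := by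
    intro l hl a ha
    have h1 : (Finset.univ : Finset (Fin n)) ⊆ G.distSphere a 5 ∪ (l.map q).toFinset := by
      intro w _
      rw [Finset.mem_union, mem_distSphere]
      by_cases h : w ∈ (l.map q).toFinset
      · exact .inr h
      · exact .inl (ha w h)
    have h2 := (Finset.card_le_card h1).trans (Finset.card_union_le _ _)
    have h3 := List.toFinset_card_le (l.map q)
    rw [List.length_map, hl] at h3
    rw [Finset.card_univ, Fintype.card_fin] at h2
    omega
  have hS0 : n ≤ (G.distSphere (q 0) 5).card + 7 := by
    refine hlow [0, 1, 2, 3, 4, 6, 7] rfl _ fun w hw ↦ ?_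
    simp only [List.map_cons, List.map_nil, List.mem_toFinset, List.mem_cons, List.not_mem_nil,
      or_false, not_or, Fin.ext_iff, hq] at hw
    norm_num at hw
    have h1 := hdist w (by omega) (by omega)
    have h2 := tri (q 0) w (q 3)
    have h3 := hl0 (q 0) w
    simp only [hq] at h3
    norm_num at h3
    split_ifs at h3 <;> omega
  have hS6 : n ≤ (G.distSphere (q 6) 5).card + 7 := by
    refine hlow [0, 2, 3, 4, 5, 6, 7] rfl _ fun w hw ↦ ?_
    simp only [List.map_cons, List.map_nil, List.mem_toFinset, List.mem_cons, List.not_mem_nil,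
      or_false, not_or, Fin.ext_iff, hq] at hw
    norm_num at hw
    have h1 := hdist w (by omega) (by omega)
    have h2 := tri (q 6) w (q 3)
    have h3 := hl6 (q 6) w
    simp only [hq] at h3
    norm_num at h3
    split_ifs at h3 <;> omega
  have h5 : (G.distSphere (q 0) 5).card + (G.distSphere (q 6) 5).card ≤ G.numPairsAtDist 5 :=
    card_distSphere_add_le_numPairsAtDist (by rintro h; rw [h] at h06; simp at h06) (by omega)
  -- a leaf at the vertex `7` is at distance four from the vertices `1` and `5` only
  have h4leaf : ∀ a b : Fin n, 8 ≤ a.val → G.dist a b = 4 → b ∈ ({q 1, q 5} : Finset (Fin n)) := by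
    intro a b ha hab
    rw [Finset.mem_insert, Finset.mem_singleton]
    have h7a := dist_eq_one_iff_adj.2 (hleaf a ha)
    have h3a := hdist a (by omega) (by omega)
    by_cases hb : 8 ≤ b.val
    · have h7b := dist_eq_one_iff_adj.2 (hleaf b hb)
      have := tri a b (q 7)
      omega
    · have h3b := tri a b (q 3)
      obtain h | h | h | h | h | h | h | h : b.val = 0 ∨ b.val = 1 ∨ b.val = 2 ∨ b.val = 3 ∨
        b.val = 4 ∨ b.val = 5 ∨ b.val = 6 ∨ b.val = 7 := by omega
      · have h1 := hl0 b a
        norm_num [h] at h1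
        rw [dist_comm] at h1
        split_ifs at h1 <;> omega
      · exact .inl (hq' b 1 h)
      · rw [hq' b 2 h] at hab h3b; omega
      · rw [hq' b 3 h] at hab h3b; omega
      · rw [hq' b 4 h] at hab h3b; omega
      · exact .inr (hq' b 5 h)
      · have h1 := hl6 b a
        norm_num [h] at h1
        rw [dist_comm] at h1
        split_ifs at h1 <;> omega
      · rw [hq' b 7 h] at hab h3b; omega
  have h4 : G.numPairsAtDist 4 ≤ 2 * n + 16 := by
    set A : Finset (Fin n) := Finset.univ.filter fun i ↦ i.val < 8 with hA
    have hAcard : A.card = 8 := by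
      rw [hA, Fin.card_filter_val_lt]; omega
    have hBcard : Aᶜ.card + 8 = n := by
      rw [Finset.card_compl, hAcard, Fintype.card_fin]; omega
    have hsub : G.distPairs 4 ⊆ A ×ˢ A ∪ (Aᶜ ×ˢ {q 1, q 5} ∪ {q 1, q 5} ×ˢ Aᶜ) := by
      rintro ⟨a, b⟩ h
      rw [mem_distPairs] at h
      simp only at h
      rw [Finset.mem_union, Finset.mem_union, Finset.mem_product, Finset.mem_product,
        Finset.mem_product]
      have hmem : ∀ a, a ∈ Aᶜ ↔ 8 ≤ a.val := fun a ↦ by simp [hA]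
      by_cases ha : 8 ≤ a.val
      · exact .inr (.inl ⟨(hmem a).2 ha, h4leaf a b ha h⟩)
      by_cases hb : 8 ≤ b.val
      · exact .inr (.inr ⟨h4leaf b a hb (by rwa [dist_comm]), (hmem b).2 hb⟩)
      · exact .inl ⟨by simp [hA]; omega, by simp [hA]; omega⟩
    have h1 := (Finset.card_le_card hsub).trans ((Finset.card_union_le _ _).trans
      (add_le_add le_rfl (Finset.card_union_le _ _)))
    have h2 : ({q 1, q 5} : Finset (Fin n)).card ≤ 2 := Finset.card_le_two
    rw [Finset.card_product, Finset.card_product, Finset.card_product, hAcard,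
      ← two_mul_numPairsAtDist G four_ne_zero] at h1
    nlinarith
  have h2 : 2 * G.numPairsAtDist 2 ≤ n ^ 2 := by
    have := G.sum_card_distPairs_le {2}
    rwa [Finset.sum_singleton, Fintype.card_fin, ← two_mul_numPairsAtDist G two_ne_zero] at this
  have hn' : (31 : ℝ) ≤ n := by exact_mod_cast hn
  obtain ⟨t, ht, ht0⟩ := exists_lt_quintic_eq_zero (n := n) (a := G.numPairsAtDist 5)
    (b := G.numPairsAtDist 4) (c := G.numPairsAtDist 3) (d := G.numPairsAtDist 2)
    (e := G.numPairsAtDist 1) hn'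
    (by
      rw [sub_le_iff_le_add]
      exact_mod_cast (show 2 * n ≤ G.numPairsAtDist 5 + 14 by omega))
    (by positivity) (by exact_mod_cast h4) (by positivity) (by positivity)
    (by exact_mod_cast (show G.numPairsAtDist 2 ≤ n ^ 2 by omega)) (by positivity)
  refine ⟨t, ?_, ?_⟩
  · rw [isWienerRoot_iff, hdiam]
    simp only [Finset.sum_range_succ, Finset.sum_range_zero, zero_add, Nat.reduceAdd, h6]
    rw [← Complex.ofReal_zero, ← ht0]
    push_cast
    ring
  · rw [Complex.norm_real, Real.norm_of_nonpos (by linarith)]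
    linarith

/-! ### Comparison of all trees of the same order -/

lemma Iso.dist_eq {W : Type*} {H : SimpleGraph W} (e : G ≃g H) (hG : G.Connected)
    (hH : H.Connected) (u v : V) : H.dist (e u) (e v) = G.dist u v := by
  refine le_antisymm ?_ ?_
  · obtain ⟨p, hp⟩ := hG.exists_walk_length_eq_dist u v
    rw [← hp, ← Walk.length_map e.toHom]
    exact dist_le _
  · obtain ⟨p, hp⟩ := hH.exists_walk_length_eq_dist (e u) (e v)
    have h := dist_le (p.map e.symm.toHom)
    rw [Walk.length_map, hp] at h
    simpa using h

lemma Iso.isWienerRoot_iff {W : Type*} [Finite V] {H : SimpleGraph W} (e : G ≃g H)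
    (hG : G.Connected) {z : ℂ} : G.IsWienerRoot z ↔ H.IsWienerRoot z := by
  have hH : H.Connected := e.connected_iff.1 hG
  have := Finite.of_equiv V e.toEquiv
  have hd := e.dist_eq hG hH
  have hdiam : G.diam = H.diam := by
    have := hG.nonempty
    have := hH.nonempty
    obtain ⟨a, b, hab⟩ := G.exists_dist_eq_diam
    obtain ⟨a', b', hab'⟩ := H.exists_dist_eq_diam
    refine le_antisymm ?_ ?_
    · rw [← hab, ← hd]
      exact hH.dist_le_diam _ _
    · rw [← hab', ← e.apply_symm_apply a', ← e.apply_symm_apply b', hd]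
      exact hG.dist_le_diam _ _
  have hnum : ∀ i, G.numPairsAtDist i = H.numPairsAtDist i := by
    intro i
    rw [numPairsAtDist, numPairsAtDist,
      ← Set.ncard_image_of_injective _ (Sym2.map.injective e.injective)]
    congr 1
    ext s
    constructor
    · rintro ⟨_, ⟨u, v, rfl, h⟩, rfl⟩
      exact ⟨e u, e v, Sym2.map_mk .., by rw [hd, h]⟩
    · rintro ⟨u, v, rfl, h⟩
      refine ⟨s(e.symm u, e.symm v), ⟨_, _, rfl, ?_⟩, by simp⟩
      rw [← hd, e.apply_symm_apply, e.apply_symm_apply, h]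
  rw [SimpleGraph.isWienerRoot_iff, SimpleGraph.isWienerRoot_iff, hdiam]
  simp only [hnum]

/-- All trees of order `n` other than `treeT n` have their Wiener roots in the closed disc of
radius `2 * n - 16`. -/
lemma IsTree.nonempty_iso_treeT_or_norm_le [Fintype V] (hG : G.IsTree)
    (hn : 31 ≤ Fintype.card V) : Nonempty (G ≃g treeT (Fintype.card V)) ∨
      ∀ z, G.IsWienerRoot z → ‖z‖ ≤ 2 * Fintype.card V - 16 := by
  have hn' : (31 : ℝ) ≤ Fintype.card V := by exact_mod_cast hn
  by_cases hratio : ∀ i, i + 1 < G.diam → (G.numPairsAtDist (i + 1) : ℝ) ≤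
      (2 * Fintype.card V - 16) * G.numPairsAtDist (i + 1 + 1)
  · right
    intro z hz
    rw [SimpleGraph.isWienerRoot_iff] at hz
    have : Nontrivial V := Fintype.one_lt_card_iff_nontrivial.1 (by omega)
    refine norm_le_of_sum_mul_pow_eq_zero (connected_iff_diam_ne_zero.1 hG.connected)
      (by linarith) (fun i hi ↦ ?_) hratio hz
    exact_mod_cast hG.connected.numPairsAtDist_pos i.succ_ne_zero hi
  · push Not at hratio
    obtain ⟨i, hi, hlt⟩ := hratio
    obtain ⟨u, x, hux, hux'⟩ : ∃ u x, G.dist u x = i + 1 + 1 ∧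
        2 * (Fintype.card V : ℝ) - 16 < G.sphereRatio (i + 1) u + G.sphereRatio (i + 1) x := by
      by_contra! h
      exact hlt.not_ge (hG.numPairsAtDist_le_mul i.succ_ne_zero hi h)
    obtain ⟨hi35, hu, hx, hsum⟩ := hG.of_lt_sphereRatio_add hn hux hux'
    rcases hi35 with hi3 | hi5
    · obtain rfl : i = 2 := by omega
      exact .inr ((hG.of_extremal_pair_at_dist_four hn hux hu hx hsum).resolve_left hlt.not_ge)
    · obtain rfl : i = 4 := by omega
      exact hG.of_extremal_pair_at_dist_six hn hux hsum

lemma IsTree.nonempty_iso_treeT_of_lt [Finite V] (hG : G.IsTree) {n : ℕ} (hn : 31 ≤ n)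
    (hV : Nat.card V = n) {z : ℂ} (hz : G.IsWienerRoot z) (hlt : 2 * (n : ℝ) - 16 < ‖z‖) :
    Nonempty (G ≃g treeT n) := by
  have := Fintype.ofFinite V
  rw [Nat.card_eq_fintype_card] at hV
  subst hV
  exact (hG.nonempty_iso_treeT_or_norm_le hn).resolve_right fun h ↦ (h z hz).not_gt hlt

lemma finite_setOf_isWienerRoot [Finite V] [Nontrivial V] (hG : G.Connected) :
    {z | G.IsWienerRoot z}.Finite := by
  have := Fintype.ofFinite V
  have hne : G.reducedWienerPoly ≠ 0 := by
    intro h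
    -- the value at `1` is the number of pairs of distinct vertices
    have h1 : G.IsWienerRoot 1 := by rw [IsWienerRoot, h]; simp
    rw [SimpleGraph.isWienerRoot_iff] at h1
    simp only [one_pow, mul_one] at h1
    rw [← Complex.ofReal_sum, Complex.ofReal_eq_zero] at h1
    refine (Finset.sum_pos (fun i hi ↦ ?_) ?_).ne' h1
    · exact_mod_cast hG.numPairsAtDist_pos i.succ_ne_zero (Finset.mem_range.1 hi)
    · exact ⟨0, Finset.mem_range.2 (Nat.pos_of_ne_zero (connected_iff_diam_ne_zero.1 hG))⟩
  exact Polynomial.finite_setOfPred_isRoot hne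

lemma hasMaxModulusWienerRoot_treeT {n : ℕ} (hn : 31 ≤ n) :
    (treeT n).HasMaxModulusWienerRoot := by
  have : Nontrivial (Fin n) := Fin.nontrivial_iff_two_le.2 (by omega)
  obtain ⟨z₀, hz₀, hlt⟩ := exists_isWienerRoot_treeT hn
  obtain ⟨z, hz, hmax⟩ := (finite_setOf_isWienerRoot (connected_treeT (n := n)
    (by omega))).exists_maximalFor (fun z ↦ ‖z‖) _ ⟨z₀, hz₀⟩
  have hmax' : ∀ w, (treeT n).IsWienerRoot w → ‖w‖ ≤ ‖z‖ := fun w hw ↦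
    (le_total ‖w‖ ‖z‖).elim id (hmax hw)
  refine ⟨z, hz, fun S hS w hw ↦ ?_⟩
  by_contra! h
  obtain ⟨e⟩ := hS.nonempty_iso_treeT_of_lt hn (by simp) hw
    (hlt.trans_le ((hmax' z₀ hz₀).trans h.le))
  exact h.not_ge (hmax' w ((e.isWienerRoot_iff hS.connected).1 hw))

end SimpleGraph

/-- For `n ≥ 31`, `T_n` is a tree (on `n` vertices), and among the trees of order `n` those with a
Wiener root of maximum modulus are precisely the ones isomorphic to `T_n`. -/
theorem theorem3 (n : ℕ) (hn : 31 ≤ n) :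
    (SimpleGraph.treeT n).IsTree ∧
      (SimpleGraph.treeT n).HasMaxModulusWienerRoot ∧
      ∀ {V : Type*} [Finite V] (T : SimpleGraph V), T.IsTree → Nat.card V = n →
        (T.HasMaxModulusWienerRoot ↔ Nonempty (T ≃g SimpleGraph.treeT n)) := by
  have hmax := SimpleGraph.hasMaxModulusWienerRoot_treeT hn
  refine ⟨SimpleGraph.isTree_treeT (by omega), hmax, fun {V} _ T hT hV ↦ ⟨?_, ?_⟩⟩
  · rintro ⟨z, hz, hzmax⟩
    obtain ⟨z₀, hz₀, hlt⟩ := SimpleGraph.exists_isWienerRoot_treeT hn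
    rw [hV] at hzmax
    exact hT.nonempty_iso_treeT_of_lt hn hV hz
      (hlt.trans_le (hzmax _ (SimpleGraph.isTree_treeT (by omega)) z₀ hz₀))
  · rintro ⟨e⟩
    obtain ⟨z, hz, hzmax⟩ := hmax
    rw [Nat.card_fin] at hzmax
    refine ⟨z, (e.isWienerRoot_iff hT.connected).2 hz, ?_⟩
    rw [hV]
    exact hzmax
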